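/- Let $k$ be a field of characteristic $0$ and let $B_n=\langle\sigma_1,\dots,\sigma_{n-1}\rangle$ be the braid group on $n$ strands. For a finite quotient $B_n\twoheadrightarrow Q$ the group algebra $k[Q]$ is a right $k[B_n]$-module; these modules form an inverse system $\widehat{\mathrm{BrAss}}(n)=\{k[Q]\}_Q$ over all finite quotients $Q$ of $B_n$ (pro-objects are taken in right $k[B_n]$-modules). Let $\widetilde\tau\in B_n$ be the Matsumoto lift of $\tau\in S_n$ (write $\tau$ as a word of minimal length in the adjacent transpositions $(i,i+1)$ and replace each of them by $\sigma_i$), and put $$\mathfrak S_{p,q}=\sum_{\tau}\widetilde\tau\in k[B_{p+q}],\qquad \mathfrak S_n=\sum_{\tau\in S_n}\widetilde\tau\in k[B_n],$$ where the first sum is over the $(p,q)$-unshuffles $\tau$, i.e. those $\tau\in S_{p+q}$ for which $\tau^{-1}$ is increasing on $\{1,\dots,p\}$ and on $\{p+1,\dots,p+q\}$. Define sub-inverse systems of $\widehat{\mathrm{BrAss}}(n)$ by $$\mathrm{BrPrim}(n)_Q=\bigcap_{p+q=n,\;p,q>0}\ker\big(\mathfrak S_{p,q}\cdot-:k[Q]\to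 k[Q]\big)\ (n\ge 2),\qquad \mathrm{BrPrim}(0)=\mathrm{BrPrim}(1)=0,$$ $$\mathfrak W(n)_Q=\ker\big(\mathfrak S_n\cdot-:k[Q]\to k[Q]\big).$$ Let $\circ_i$ denote the operadic compositions of $\widehat{\mathrm{BrAss}}$, induced by the cabling maps $\circ_i:B_m\times B_l\to B_{m+l-1}$ (replace the $i$-th strand of the first braid by a tube filled with the second braid). For $(\mathcal C,\mathcal M)=(\mathrm{BrPrim},\mathrm{BrPrim})$ or $(\widehat{\mathrm{BrAss}}_{>1},\mathfrak W)$, where $\widehat{\mathrm{BrAss}}_{>1}$ is the part of $\widehat{\mathrm{BrAss}}$ in arities $>1$, the indecomposables $Q_{\mathcal C}(\mathcal M)(n)$ are the cokernel (as a pro-object) of $$\sum_{m=2}^{n-1}\sum_{i=1}^m\circ_i:\ \bigoplus_{m,i}\mathrm{Ind}_{B_m^i\times B_{n-m+1}}^{B_n}\big(\mathcal C(m)\otimes\mathcal M(n-m+1)\big)\to\mathcal M(n),$$ where $B_m^i\le B_m$ is the subgroup of braids whose permutation fixes $i$. Write $Q(\mathrm{BrPrim})=Q_{\mathrm{BrPrim}}(\mathrm{BrPrim})$.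 An inverse system $V=\{V_j\}_{j\in J}$ of right $k[B_n]$-modules is *pro-cyclic*, with generator $v\in\varprojlim_j V_j$, if the image of $v$ in $V_h$ generates the $k[B_n]$-module $V_h$ for all $h$ in a cofinal subsystem of $J$. **Theorem.** Let $n\ge 2$. 1. $\mathrm{BrPrim}(n)$ and $Q(\mathrm{BrPrim})(n)$ are nonzero as pro-objects and pro-cyclic. For every finite quotient $Q$ of $B_n$ there is a unique idempotent $g_{n,Q}\in k[Q]$ with $g_{n,Q}\,k[Q]=\mathrm{BrPrim}(n)_Q$ that is fixed by the antipode of $k[Q]$ (the linear map inverting group elements); the $g_{n,Q}$ are compatible and define the braided Garsia idempotent $g_n\in\varprojlim_Q\mathrm{BrPrim}(n)_Q$. This $g_n$ is a generator of $\mathrm{BrPrim}(n)$, and its image in $\varprojlim Q(\mathrm{BrPrim})(n)$ is nonzero and a generator of $Q(\mathrm{BrPrim})(n)$. In particular $\mathrm{BrPrim}$ has indecomposable operations in every arity $n\ge 2$. 2. $\mathfrak W(n)$ and $Q_{\widehat{\mathrm{BrAss}}_{>1}}(\mathfrak W)(n)$ are nonzero as pro-objects and pro-cyclic. The unique antipode-fixed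 idempotents $h_{n,Q}\in k[Q]$ with $h_{n,Q}\,k[Q]=\mathfrak W(n)_Q$ exist for every finite quotient $Q$ of $B_n$, are compatible, and define $h_n\in\varprojlim_Q\mathfrak W(n)_Q$; this $h_n$ is a generator of $\mathfrak W(n)$, and its image in $\varprojlim Q_{\widehat{\mathrm{BrAss}}_{>1}}(\mathfrak W)(n)$ is nonzero and a generator of $Q_{\widehat{\mathrm{BrAss}}_{>1}}(\mathfrak W)(n)$. -/

import Mathlib

open CategoryTheory MulOpposite

/-! ### Braid groups -/

/-- The defining relators of the braid group on `n` strands; the `n - 1` generators are numbered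
from `0`, generator `j` being the crossing of the strands `j` and `j + 1`. -/
inductive BraidRel (n : ℕ) : FreeGroup (Fin (n - 1)) → Prop
  | braid (i j : Fin (n - 1)) (h : (i : ℕ) + 1 = j) :
      BraidRel n (FreeGroup.of i * FreeGroup.of j * FreeGroup.of i *
        (FreeGroup.of j * FreeGroup.of i * FreeGroup.of j)⁻¹)
  | comm (i j : Fin (n - 1)) (h : (i : ℕ) + 1 < j) :
      BraidRel n (FreeGroup.of i * FreeGroup.of j * (FreeGroup.of j * FreeGroup.of i)⁻¹)

/-- The braid group on `n` strands (trivial for `n = 0, 1`), by Artin's presentation. -/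
abbrev BraidGroup (n : ℕ) : Type := PresentedGroup {r | BraidRel n r}

/-- The generator crossing the strands `j` and `j + 1` (counted from `0`), set to be `1` when
there are no such strands. -/
def braidGen (n j : ℕ) : BraidGroup n :=
  if h : j < n - 1 then PresentedGroup.of ⟨j, h⟩ else 1

theorem braidGen_braid {n j : ℕ} (h : j + 1 < n - 1) :
    braidGen n j * braidGen n (j + 1) * braidGen n j =
      braidGen n (j + 1) * braidGen n j * braidGen n (j + 1) := by
  have h0 : j < n - 1 := by omega
  have := PresentedGroup.one_of_mem (rels := {r | BraidRel n r})
    (BraidRel.braid ⟨j, h0⟩ ⟨j + 1, h⟩ rfl)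
  simp only [map_mul, map_inv] at this
  simp only [braidGen, dif_pos h0, dif_pos h]
  exact mul_inv_eq_one.1 this

theorem braidGen_comm {n i j : ℕ} (h : i + 1 < j) :
    braidGen n i * braidGen n j = braidGen n j * braidGen n i := by
  by_cases hj : j < n - 1
  · have hi : i < n - 1 := by omega
    have := PresentedGroup.one_of_mem (rels := {r | BraidRel n r})
      (BraidRel.comm ⟨i, hi⟩ ⟨j, hj⟩ h)
    simp only [map_mul, map_inv] at this
    simp only [braidGen, dif_pos hi, dif_pos hj]
    exact mul_inv_eq_one.1 this
  · simp [braidGen, dif_neg hj]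

/-- A homomorphism out of the braid group from images of the generators that satisfy the braid
relations. -/
def braidLift {n : ℕ} {G : Type*} [Group G] (f : ℕ → G)
    (hb : ∀ j, j + 1 < n - 1 → f j * f (j + 1) * f j = f (j + 1) * f j * f (j + 1))
    (hc : ∀ i j, i + 1 < j → j < n - 1 → f i * f j = f j * f i) : BraidGroup n →* G :=
  PresentedGroup.toGroup (f := fun j : Fin (n - 1) => f j) (by
    rintro r (⟨i, j, h⟩ | ⟨i, j, h⟩)
    · simp only [map_mul, map_inv, FreeGroup.lift_apply_of, mul_inv_eq_one, ← h]
      exact hb i (h ▸ j.2)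
    · simp only [map_mul, map_inv, FreeGroup.lift_apply_of, mul_inv_eq_one]
      exact hc i j h j.2)

/-! ### Cabling -/

/-- `σ_j σ_{j+1} ⋯ σ_{j+l-1}`: a cable of `l` strands at `j, …, j+l-1` crosses the strand `j+l`. -/
def cableUp (n j : ℕ) : ℕ → BraidGroup n
  | 0 => 1
  | l + 1 => cableUp n j l * braidGen n (j + l)

/-- `σ_{j+l-1} ⋯ σ_{j+1} σ_j`: the strand `j` crosses a cable of `l` strands at `j+1, …, j+l`. -/
def cableDown (n j : ℕ) : ℕ → BraidGroup n
  | 0 => 1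
  | l + 1 => braidGen n (j + l) * cableDown n j l

theorem braidGen_comm_cableUp {n a j l : ℕ} (h : a + 1 < j ∨ j + l < a) :
    braidGen n a * cableUp n j l = cableUp n j l * braidGen n a := by
  induction l with
  | zero => simp [cableUp]
  | succ l ih =>
    have h1 : braidGen n a * braidGen n (j + l) = braidGen n (j + l) * braidGen n a := by
      rcases h with h | h
      · exact braidGen_comm (by omega)
      · exact (braidGen_comm (by omega)).symm
    rw [cableUp, ← mul_assoc, ih (by omega), mul_assoc, h1, mul_assoc]

theorem braidGen_comm_cableDown {n a j l : ℕ} (h : a + 1 < j ∨ j + l < a) :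
    braidGen n a * cableDown n j l = cableDown n j l * braidGen n a := by
  induction l with
  | zero => simp [cableDown]
  | succ l ih =>
    have h1 : braidGen n a * braidGen n (j + l) = braidGen n (j + l) * braidGen n a := by
      rcases h with h | h
      · exact braidGen_comm (by omega)
      · exact (braidGen_comm (by omega)).symm
    rw [cableDown, ← mul_assoc, h1, mul_assoc, ih (by omega), mul_assoc]

theorem cable_braid_up {n j l : ℕ} (h : j + l < n - 1) :
    braidGen n j * cableUp n (j + 1) l * cableUp n j l =
      cableUp n (j + 1) l * cableUp n j l * braidGen n (j + l) := by
  induction l with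
  | zero => simp [cableUp]
  | succ l ih =>
    have ih := ih (by omega)
    have c := braidGen_comm_cableUp (n := n) (a := j + l + 1) (j := j) (l := l) (by omega)
    have b := braidGen_braid (n := n) (j := j + l) (by omega)
    rw [cableUp, cableUp, show j + 1 + l = j + l + 1 by omega, show j + (l + 1) = j + l + 1 by omega]
    calc _ = braidGen n j * cableUp n (j + 1) l * (braidGen n (j + l + 1) * cableUp n j l) *
              braidGen n (j + l) := by group
      _ = (braidGen n j * cableUp n (j + 1) l * cableUp n j l) * braidGen n (j + l + 1) *
              braidGen n (j + l) := by rw [c]; group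
      _ = cableUp n (j + 1) l * cableUp n j l *
              (braidGen n (j + l) * braidGen n (j + l + 1) * braidGen n (j + l)) := by
            rw [ih]; group
      _ = cableUp n (j + 1) l * (cableUp n j l * braidGen n (j + l + 1)) *
              braidGen n (j + l) * braidGen n (j + l + 1) := by rw [b]; group
      _ = _ := by rw [← c]; group

theorem cable_braid_mid {n j l : ℕ} (h : j + l < n - 1) :
    cableUp n j l * braidGen n (j + l) * cableDown n j l =
      cableDown n (j + 1) l * braidGen n j * cableUp n (j + 1) l := by
  induction l with
  | zero => simp [cableUp, cableDown]
  | succ l ih =>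
    have ih := ih (by omega)
    have c := braidGen_comm_cableUp (n := n) (a := j + l + 1) (j := j) (l := l) (by omega)
    have c' := braidGen_comm_cableDown (n := n) (a := j + l + 1) (j := j) (l := l) (by omega)
    have b := braidGen_braid (n := n) (j := j + l) (by omega)
    simp only [cableUp, cableDown, show j + 1 + l = j + l + 1 by omega,
      show j + (l + 1) = j + l + 1 by omega]
    calc _ = cableUp n j l *
              (braidGen n (j + l) * braidGen n (j + l + 1) * braidGen n (j + l)) *
              cableDown n j l := by group
      _ = (cableUp n j l * braidGen n (j + l + 1)) * braidGen n (j + l) *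
              (braidGen n (j + l + 1) * cableDown n j l) := by rw [b]; group
      _ = braidGen n (j + l + 1) *
              (cableUp n j l * braidGen n (j + l) * cableDown n j l) *
              braidGen n (j + l + 1) := by rw [← c, c']; group
      _ = _ := by rw [ih]; group

theorem cable_braid_down {n j l : ℕ} (h : j + l < n - 1) :
    cableDown n j l * cableDown n (j + 1) l * braidGen n j =
      braidGen n (j + l) * cableDown n j l * cableDown n (j + 1) l := by
  induction l with
  | zero => simp [cableDown]
  | succ l ih =>
    have ih := ih (by omega)
    have c := braidGen_comm_cableDown (n := n) (a := j + l + 1) (j := j) (l := l) (by omega)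
    have b := braidGen_braid (n := n) (j := j + l) (by omega)
    rw [cableDown, cableDown, show j + 1 + l = j + l + 1 by omega,
      show j + (l + 1) = j + l + 1 by omega]
    calc _ = braidGen n (j + l) * (cableDown n j l * braidGen n (j + l + 1)) *
              cableDown n (j + 1) l * braidGen n j := by group
      _ = braidGen n (j + l) * braidGen n (j + l + 1) *
              (cableDown n j l * cableDown n (j + 1) l * braidGen n j) := by rw [← c]; group
      _ = (braidGen n (j + l) * braidGen n (j + l + 1) * braidGen n (j + l)) *
              cableDown n j l * cableDown n (j + 1) l := by rw [ih]; group
      _ = braidGen n (j + l + 1) * braidGen n (j + l) *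
              (braidGen n (j + l + 1) * cableDown n j l) * cableDown n (j + 1) l := by
            rw [b]; group
      _ = _ := by rw [c]; group

/-- The adjacent transposition `(j, j+1)` of `{0, …, m-1}`, or `1` when out of range. -/
def adjSwap (m j : ℕ) : Equiv.Perm (Fin m) :=
  if h : j + 1 < m then Equiv.swap ⟨j, by omega⟩ ⟨j + 1, h⟩ else 1

/-- The braid on `n = m + l - 1` strands got from the generator `σ_j` on `m` strands by replacing
the strand whose *final* position is `a` by `l` parallel strands. -/
def cableGen (n l j a : ℕ) : BraidGroup n :=
  if a < j then braidGen n (j + l - 1)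
  else if a = j then cableDown n j l
  else if a = j + 1 then cableUp n j l
  else braidGen n j

/-- Pairs of a family `f` (indexed by final positions of the strands) of braids on `n` strands and
a permutation of `m` strands. -/
abbrev CableTarget (m n : ℕ) : Type :=
  (Fin m → BraidGroup n) ⋊[mulAutArrow] Equiv.Perm (Fin m)

theorem adjSwap_val {m j : ℕ} (h : j + 1 < m) (a : Fin m) :
    ((adjSwap m j a : Fin m) : ℕ) =
      if (a : ℕ) = j then j + 1 else if (a : ℕ) = j + 1 then j else a := by
  rw [adjSwap, dif_pos h, Equiv.swap_apply_def]
  simp only [Fin.ext_iff]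
  split_ifs <;> rfl

theorem adjSwap_inv (m j : ℕ) : (adjSwap m j)⁻¹ = adjSwap m j := by
  unfold adjSwap
  split_ifs <;> simp

theorem cable_arrow_apply {m n : ℕ} (τ : Equiv.Perm (Fin m)) (f : Fin m → BraidGroup n)
    (a : Fin m) : mulAutArrow τ f a = f (τ⁻¹ a) := rfl

/-- The image of the generator `σ_j`: its cablings, together with its permutation. -/
def cableGenPair (m l n j : ℕ) : CableTarget m n :=
  ⟨fun a => cableGen n l j a, adjSwap m j⟩

theorem cableGenPair_braid {m l n : ℕ} (h : m + l = n + 1) (j : ℕ) (hj : j + 1 < m - 1) :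
    cableGenPair m l n j * cableGenPair m l n (j + 1) * cableGenPair m l n j =
      cableGenPair m l n (j + 1) * cableGenPair m l n j * cableGenPair m l n (j + 1) := by
  have h1 : j + 1 < m := by omega
  have h2 : j + 1 + 1 < m := by omega
  apply SemidirectProduct.ext
  · funext a
    simp only [SemidirectProduct.mul_left, SemidirectProduct.mul_right, cableGenPair,
      Pi.mul_apply, cable_arrow_apply, mul_inv_rev, adjSwap_inv,
      Equiv.Perm.mul_apply, adjSwap_val h1, adjSwap_val h2, cableGen]
    have e1 : j + 1 + l - 1 = j + l := by omega
    have f1 : ¬ j = j + 1 + 1 := by omega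
    have f2 : ¬ j + 1 + 1 = j := by omega
    have f3 : ¬ j + 1 + 1 < j := by omega
    have f4 : ¬ j + 1 + 1 ≤ j := by omega
    rcases lt_or_ge (a : ℕ) j with ha | ha
    · have := braidGen_braid (n := n) (j := j + l - 1) (by omega)
      rw [show j + l - 1 + 1 = j + l by omega] at this
      simp [show (a : ℕ) ≠ j by omega, show (a : ℕ) ≠ j + 1 by omega, ha,
        show (a : ℕ) ≠ j + 1 + 1 by omega, show (a : ℕ) < j + 1 by omega, e1, this]
    rcases eq_or_ne (a : ℕ) j with ha | ha1
    · have := cable_braid_down (n := n) (j := j) (l := l) (by omega)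
      simp [ha, e1, f1, f2, f3, f4, this]
    rcases eq_or_ne (a : ℕ) (j + 1) with ha | ha2
    · have := cable_braid_mid (n := n) (j := j) (l := l) (by omega)
      simp [ha, e1, f1, f2, f3, f4, this]
    rcases eq_or_ne (a : ℕ) (j + 1 + 1) with ha | ha3
    · have := cable_braid_up (n := n) (j := j) (l := l) (by omega)
      simp [ha, e1, f1, f2, f3, f4, this]
    · have := braidGen_braid (n := n) (j := j) (by omega)
      simp [ha1, ha2, ha3, show ¬ (a : ℕ) < j by omega, show ¬ (a : ℕ) < j + 1 by omega, this]
  · ext a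
    simp only [SemidirectProduct.mul_right, cableGenPair, Equiv.Perm.mul_apply,
      adjSwap_val h1, adjSwap_val h2]
    split_ifs <;> omega

theorem cableGenPair_comm {m l n : ℕ} (h : m + l = n + 1) (i j : ℕ) (hij : i + 1 < j)
    (hj : j < m - 1) :
    cableGenPair m l n i * cableGenPair m l n j =
      cableGenPair m l n j * cableGenPair m l n i := by
  have h1 : i + 1 < m := by omega
  have h2 : j + 1 < m := by omega
  apply SemidirectProduct.ext
  · funext a
    simp only [SemidirectProduct.mul_left, cableGenPair,
      Pi.mul_apply, cable_arrow_apply, adjSwap_inv,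
      adjSwap_val h1, adjSwap_val h2, cableGen]
    rcases lt_or_ge (a : ℕ) i with ha | ha
    · simp [ha, show (a : ℕ) ≠ i by omega, show (a : ℕ) ≠ i + 1 by omega,
        show (a : ℕ) ≠ j by omega, show (a : ℕ) ≠ j + 1 by omega, show (a : ℕ) < j by omega]
      exact braidGen_comm (by omega)
    rcases eq_or_ne (a : ℕ) i with ha | ha1
    · simp [ha, show i ≠ j by omega, show i ≠ j + 1 by omega, show i < j by omega, hij]
      exact (braidGen_comm_cableDown (by omega)).symm
    rcases eq_or_ne (a : ℕ) (i + 1) with ha | ha2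
    · simp [ha, show i + 1 ≠ j by omega, show i ≠ j by omega, show i < j by omega, hij]
      exact (braidGen_comm_cableUp (by omega)).symm
    rcases lt_or_ge (a : ℕ) j with ha3 | ha3
    · simp [ha1, ha2, ha3, show (a : ℕ) ≠ j by omega, show (a : ℕ) ≠ j + 1 by omega,
        show ¬ (a : ℕ) < i by omega]
      exact braidGen_comm (by omega)
    rcases eq_or_ne (a : ℕ) j with ha4 | ha4
    · simp [ha4, show j ≠ i by omega, show j ≠ i + 1 by omega, show ¬ j < i by omega,
        show ¬ j + 1 < i by omega, show j + 1 ≠ i by omega]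
      exact braidGen_comm_cableDown (by omega)
    rcases eq_or_ne (a : ℕ) (j + 1) with ha5 | ha5
    · simp [ha5, show j ≠ i by omega, show j ≠ i + 1 by omega, show ¬ j < i by omega,
        show ¬ j + 1 < i by omega, show j + 1 ≠ i by omega]
      exact braidGen_comm_cableUp (by omega)
    · simp [ha1, ha2, ha4, ha5, show ¬ (a : ℕ) < i by omega, show ¬ (a : ℕ) < j by omega]
      exact braidGen_comm (by omega)
  · ext a
    simp only [SemidirectProduct.mul_right, cableGenPair, Equiv.Perm.mul_apply,
      adjSwap_val h1, adjSwap_val h2]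
    split_ifs <;> omega

/-- The homomorphism recording all cablings of a braid on `m` strands by `l` parallel strands
(indexed by the final position of the cabled strand), together with its permutation. -/
def cableHom {m l n : ℕ} (h : m + l = n + 1) : BraidGroup m →* CableTarget m n :=
  braidLift (cableGenPair m l n) (cableGenPair_braid h) (cableGenPair_comm h)

/-- The homomorphism placing a braid on `l` strands onto the strands `i, …, i + l - 1`. -/
def insertHom {m l n : ℕ} (h : m + l = n + 1) (i : Fin m) : BraidGroup l →* BraidGroup n :=
  braidLift (fun j => braidGen n (i + j))
    (fun j hj => braidGen_braid (by have := i.2; omega))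
    (fun a b hab _ => braidGen_comm (by omega))

/-- The cabling map `γ ∘_i ρ`, on `n = m + l - 1` strands. A product `β β'` of braids performs
`β'` first; strands are named by their initial position. So `ρ` is first performed on the strands
`i, …, i + l - 1`, which are then moved as one thick strand according to `γ`. -/
def cable {m l n : ℕ} (h : m + l = n + 1) (i : Fin m) (γ : BraidGroup m) (ρ : BraidGroup l) :
    BraidGroup n :=
  (cableHom h γ).left ((cableHom h γ).right i) * insertHom h i ρ

/-! ### The Matsumoto section and the shuffle elements -/

theorem exists_adjSwap_word {n : ℕ} (τ : Equiv.Perm (Fin n)) :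
    ∃ w : List (Fin (n - 1)), (w.map fun j => adjSwap n j).prod = τ := by
  match n, τ with
  | 0, τ => exact ⟨[], Subsingleton.elim _ _⟩
  | n + 1, τ =>
    have hτ : τ ∈ (⊤ : Submonoid (Equiv.Perm (Fin (n + 1)))) := trivial
    rw [← Equiv.Perm.mclosure_swap_castSucc_succ] at hτ
    induction hτ using Submonoid.closure_induction with
    | mem x hx =>
      obtain ⟨i, rfl⟩ := hx
      refine ⟨[i], ?_⟩
      simp [adjSwap]
      rfl
    | one => exact ⟨[], rfl⟩
    | mul x y _ _ hx hy =>
      obtain ⟨u, rfl⟩ := hx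
      obtain ⟨v, rfl⟩ := hy
      exact ⟨u ++ v, by simp⟩

/-- `w` is a word of minimal length for `τ` in the adjacent transpositions. -/
def IsReducedWord {n : ℕ} (τ : Equiv.Perm (Fin n)) (w : List (Fin (n - 1))) : Prop :=
  (w.map fun j => adjSwap n j).prod = τ ∧
    ∀ w' : List (Fin (n - 1)), (w'.map fun j => adjSwap n j).prod = τ → w.length ≤ w'.length

theorem exists_isReducedWord {n : ℕ} (τ : Equiv.Perm (Fin n)) : ∃ w, IsReducedWord τ w := by
  obtain ⟨w, hw, hmin⟩ := exists_minimalFor_of_wellFoundedLT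
    (fun w : List (Fin (n - 1)) => (w.map fun j => adjSwap n j).prod = τ) List.length
    (exists_adjSwap_word τ)
  exact ⟨w, hw, fun w' hw' => (le_total _ _).elim id (hmin hw')⟩

/-- The Matsumoto lift of `τ`: the product of the braid generators along a minimal length word
for `τ` (by Matsumoto's theorem, any such word gives the same braid). -/
noncomputable def matsumotoLift {n : ℕ} (τ : Equiv.Perm (Fin n)) : BraidGroup n :=
  ((exists_isReducedWord τ).choose.map fun j => braidGen n j).prod

/-- `τ` is a `(p, n - p)`-unshuffle: its inverse is increasing on the first `p` and on the last
`n - p` elements. -/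
def IsUnshuffle {n : ℕ} (p : ℕ) (τ : Equiv.Perm (Fin n)) : Prop :=
  ∀ i j : Fin n, i < j → ((j : ℕ) < p ∨ p ≤ (i : ℕ)) → τ⁻¹ i < τ⁻¹ j

open Classical in
/-- `𝕊_{p, n - p}`, the sum of the Matsumoto lifts of the `(p, n - p)`-unshuffles. -/
noncomputable def unshuffleSum (k : Type*) [Field k] (n p : ℕ) : MonoidAlgebra k (BraidGroup n) :=
  ∑ τ : Equiv.Perm (Fin n) with IsUnshuffle p τ, MonoidAlgebra.single (matsumotoLift τ) 1

/-- The quantum symmetrizer `𝕊_n`. -/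
noncomputable def symmetrizer (k : Type*) [Field k] (n : ℕ) : MonoidAlgebra k (BraidGroup n) :=
  ∑ τ : Equiv.Perm (Fin n), MonoidAlgebra.single (matsumotoLift τ) 1

/-! ### Pro-objects

A pro-object is a functor from a cofiltered category; the index categories needed here are
codirected preorders. -/

section ProObjects

universe u v w

variable {A : Type u} [Ring A] {J : Type v} [Preorder J]

/-- A pro-object is zero iff its identity is zero in `lim_j colim_i Hom(V_i, V_j)`, that is, iff
each `V_j` receives the zero map from some `V_i`. -/
def IsProZero [IsCofiltered J] (V : J ⥤ ModuleCat.{w} A) : Prop :=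
  ∀ j, ∃ (i : J) (f : i ⟶ j), V.map f = 0

/-- The elements of the limit of an inverse system. -/
abbrev ProLimit (V : J ⥤ ModuleCat.{w} A) : Type _ := (V ⋙ forget (ModuleCat.{w} A)).sections

/-- The term at `j` of an element of the limit. -/
abbrev ProLimit.term {V : J ⥤ ModuleCat.{w} A} (v : ProLimit V) (j : J) : V.obj j := v.1 j

/-- An element `v` of the limit of the system `V` whose image `v_h` generates the `A`-module `V_h`
for all `h` in a cofinal subsystem. -/
def IsProGenerator [IsCofiltered J] (V : J ⥤ ModuleCat.{w} A) (v : ProLimit V) :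
    Prop :=
  ∃ H : Set J, (∀ j, ∃ h ∈ H, h ≤ j) ∧
    ∀ h ∈ H, Submodule.span A {v.term h} = ⊤

/-- The system `V` is pro-cyclic. -/
def IsProCyclic [IsCofiltered J] (V : J ⥤ ModuleCat.{w} A) : Prop :=
  ∃ v : ProLimit V, IsProGenerator V v

end ProObjects

/-! ### Finite quotients of braid groups -/

/-- The finite quotients of the braid group, given by their kernels. Smaller kernels are larger
quotients, and there is a map from the quotient by `N` to that by `M` when `N ≤ M`. -/
abbrev BraidQuot (n : ℕ) : Type := FiniteIndexNormalSubgroup (BraidGroup n)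

instance (n : ℕ) : Nonempty (BraidQuot n) := ⟨.ofSubgroup ⊤⟩

section Quotients

variable (k : Type*) [Field k] {n : ℕ}

/-- The group algebra of a finite quotient of the braid group; these form the profinite completion
of the braided associative operad. -/
abbrev QuotAlg (N : BraidQuot n) : Type _ := MonoidAlgebra k (BraidGroup n ⧸ N.toSubgroup)

/-- Right modules over the group algebra of the braid group are modules over this ring. -/
abbrev BraidAlgOp (n : ℕ) : Type _ := (MonoidAlgebra k (BraidGroup n))ᵐᵒᵖ

/-- The projection from the group algebra of the braid group. -/
noncomputable def toQuotAlg (N : BraidQuot n) : MonoidAlgebra k (BraidGroup n) →+* QuotAlg k N :=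
  MonoidAlgebra.mapDomainRingHom k (QuotientGroup.mk' N.toSubgroup)

/-- The right action of the braid group on the group algebra of a finite quotient. -/
noncomputable instance (N : BraidQuot n) : Module (BraidAlgOp k n) (QuotAlg k N) :=
  Module.compHom (QuotAlg k N) (toQuotAlg k N).op

theorem quotAlg_smul_def {N : BraidQuot n} (a : BraidAlgOp k n) (x : QuotAlg k N) :
    a • x = x * toQuotAlg k N a.unop := rfl

/-- The transition map between two finite quotients. -/
def quotMap {N M : BraidQuot n} (h : N ≤ M) :
    BraidGroup n ⧸ N.toSubgroup →* BraidGroup n ⧸ M.toSubgroup :=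
  QuotientGroup.map N.toSubgroup M.toSubgroup (MonoidHom.id _) fun _ hx => h hx

/-- The transition map between the group algebras of two finite quotients. -/
noncomputable def transRingHom {N M : BraidQuot n} (h : N ≤ M) : QuotAlg k N →+* QuotAlg k M :=
  MonoidAlgebra.mapDomainRingHom k (quotMap h)

theorem transRingHom_toQuotAlg {N M : BraidQuot n} (h : N ≤ M) (a : MonoidAlgebra k (BraidGroup n)) :
    transRingHom k h (toQuotAlg k N a) = toQuotAlg k M a := by
  have : (transRingHom k h).comp (toQuotAlg k N) = toQuotAlg k M := by
    rw [transRingHom, toQuotAlg, ← MonoidAlgebra.mapDomainRingHom_comp]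
    rfl
  exact congrArg (fun f => f a) this

/-- The transition map as a map of right modules over the group algebra of the braid group. -/
noncomputable def transHom {N M : BraidQuot n} (h : N ≤ M) :
    QuotAlg k N →ₗ[BraidAlgOp k n] QuotAlg k M where
  toFun := transRingHom k h
  map_add' := map_add _
  map_smul' a x := by
    simp only [quotAlg_smul_def, map_mul, transRingHom_toQuotAlg, RingHom.id_apply]

theorem transHom_refl {N : BraidQuot n} (x : QuotAlg k N) : transHom k (le_refl N) x = x := by
  have : transRingHom k (le_refl N) = RingHom.id _ := by
    rw [transRingHom, show quotMap (le_refl N) = MonoidHom.id _ from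
      QuotientGroup.monoidHom_ext _ rfl, MonoidAlgebra.mapDomainRingHom_id]
  exact congrArg (fun f => f x) this

theorem transHom_trans {N M L : BraidQuot n} (h : N ≤ M) (h' : M ≤ L) (x : QuotAlg k N) :
    transHom k h' (transHom k h x) = transHom k (h.trans h') x := by
  have : (transRingHom k h').comp (transRingHom k h) = transRingHom k (h.trans h') := by
    rw [transRingHom, transRingHom, transRingHom, ← MonoidAlgebra.mapDomainRingHom_comp,
      show (quotMap h').comp (quotMap h) = quotMap (h.trans h') from
        QuotientGroup.monoidHom_ext _ rfl]
  exact congrArg (fun f => f x) this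

/-- Left multiplication by an element of the group algebra of the braid group. -/
noncomputable def leftMul (N : BraidQuot n) (f : MonoidAlgebra k (BraidGroup n)) :
    QuotAlg k N →ₗ[BraidAlgOp k n] QuotAlg k N where
  toFun x := toQuotAlg k N f * x
  map_add' := mul_add _
  map_smul' a x := by simp only [quotAlg_smul_def, mul_assoc, RingHom.id_apply]

theorem transHom_leftMul {N M : BraidQuot n} (h : N ≤ M) (f : MonoidAlgebra k (BraidGroup n))
    (x : QuotAlg k N) : transHom k h (leftMul k N f x) = leftMul k M f (transHom k h x) := by
  change transRingHom k h (toQuotAlg k N f * x) = toQuotAlg k M f * transRingHom k h x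
  rw [map_mul, transRingHom_toQuotAlg]

end Quotients

/-! ### Braided subsequences of the profinite braided associative operad -/

/-- A braided subsequence of the profinite braided associative operad: for each finite quotient of
each braid group a right submodule of its group algebra, compatibly with the transition maps. -/
structure BraidedSubseq (k : Type*) [Field k] where
  obj : ∀ {n : ℕ} (N : BraidQuot n), Submodule (BraidAlgOp k n) (QuotAlg k N)
  map_mem : ∀ {n : ℕ} {N M : BraidQuot n} (h : N ≤ M) (x : QuotAlg k N),
    x ∈ obj N → transHom k h x ∈ obj M

namespace BraidedSubseq

variable {k : Type*} [Field k]

/-- The arity `n` part of a braided subsequence, as an inverse system of right modules over the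
group algebra of the braid group. -/
noncomputable def pro (C : BraidedSubseq k) (n : ℕ) : BraidQuot n ⥤ ModuleCat (BraidAlgOp k n) where
  obj N := ModuleCat.of _ (C.obj N)
  map f := ModuleCat.ofHom ((transHom k f.le).restrict (C.map_mem f.le))
  map_id N := by
    refine ModuleCat.hom_ext (LinearMap.ext fun x => Subtype.ext ?_)
    exact transHom_refl k x.1
  map_comp f g := by
    refine ModuleCat.hom_ext (LinearMap.ext fun x => Subtype.ext ?_)
    exact (transHom_trans k f.le g.le x.1).symm

variable (k)

/-- The braided primitive operad: zero in arities `0` and `1`, and in arity `n > 1` the common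
kernel of left multiplication by `𝕊_{p, q}` for `p + q = n`, `p, q > 0`. -/
noncomputable def brPrim : BraidedSubseq k where
  obj {n} N := if n ≤ 1 then ⊥ else
    ⨅ (p : ℕ) (_ : 0 < p ∧ p < n), LinearMap.ker (leftMul k N (unshuffleSum k n p))
  map_mem {n N M} h x hx := by
    split_ifs at hx ⊢ with hn
    · rw [Submodule.mem_bot] at hx ⊢
      rw [hx, map_zero]
    · simp only [Submodule.mem_iInf, LinearMap.mem_ker] at hx ⊢
      intro p hp
      rw [← transHom_leftMul, hx p hp, map_zero]

/-- The Woronowicz ideal: the kernel of left multiplication by the quantum symmetrizer. -/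
noncomputable def woronowicz : BraidedSubseq k where
  obj {n} N := LinearMap.ker (leftMul k N (symmetrizer k n))
  map_mem {n N M} h x hx := by
    rw [LinearMap.mem_ker] at hx ⊢
    rw [← transHom_leftMul, hx, map_zero]

/-- The part of the profinite braided associative operad in arities greater than `1`. -/
noncomputable def brAssGtOne : BraidedSubseq k where
  obj {n} _ := if 1 < n then ⊤ else ⊥
  map_mem {n N M} h x hx := by
    split_ifs at hx ⊢ with hn
    · trivial
    · rw [Submodule.mem_bot] at hx ⊢
      rw [hx, map_zero]

end BraidedSubseq

/-! ### Operadic composition and indecomposables -/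

/-- The condition that the cabling map `∘_i` descends to a map from the finite quotients given by
`P` and `Q` to that given by `R`. -/
def Admissible {m l n : ℕ} (h : m + l = n + 1) (i : Fin m) (P : BraidQuot m) (Q : BraidQuot l)
    (R : BraidQuot n) : Prop :=
  ∀ γ γ' ρ ρ', γ⁻¹ * γ' ∈ P → ρ⁻¹ * ρ' ∈ Q → (cable h i γ ρ)⁻¹ * cable h i γ' ρ' ∈ R

section Composition

variable {m l n : ℕ} {h : m + l = n + 1} {i : Fin m} {P : BraidQuot m} {Q : BraidQuot l} {R : BraidQuot n}

/-- The cabling map between finite quotients. -/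
def cableQuot (hA : Admissible h i P Q R) :
    BraidGroup m ⧸ P.toSubgroup → BraidGroup l ⧸ Q.toSubgroup → BraidGroup n ⧸ R.toSubgroup :=
  Quotient.map₂ (cable h i) fun γ γ' hγ ρ ρ' hρ =>
    QuotientGroup.leftRel_apply.2
      (hA γ γ' ρ ρ' (QuotientGroup.leftRel_apply.1 hγ) (QuotientGroup.leftRel_apply.1 hρ))

/-- The operadic composition `α ∘_i β` at the level of finite quotients: the bilinear extension
of the cabling map. -/
noncomputable def circ {k : Type*} [Field k] (hA : Admissible h i P Q R) (α : QuotAlg k P)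
    (β : QuotAlg k Q) : QuotAlg k R :=
  α.coeff.sum fun x a => β.coeff.sum fun y b => MonoidAlgebra.single (cableQuot hA x y) (a * b)

theorem Admissible.mono {P' : BraidQuot m} {Q' : BraidQuot l} (hA : Admissible h i P Q R) (hP : P' ≤ P)
    (hQ : Q' ≤ Q) : Admissible h i P' Q' R :=
  fun γ γ' ρ ρ' hγ hρ => hA γ γ' ρ ρ' (hP hγ) (hQ hρ)

/-- Sufficiently large finite quotients are admissible. -/
theorem exists_admissible (h : m + l = n + 1) (R : BraidQuot n) :
    ∃ (P : BraidQuot m) (Q : BraidQuot l), ∀ i, Admissible h i P Q R := by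
  let π := QuotientGroup.mk' R.toSubgroup
  let πF : (Fin m → BraidGroup n) →* (Fin m → BraidGroup n ⧸ R.toSubgroup) := π.compLeft (Fin m)
  let Ψ : CableTarget m n →*
      (Fin m → BraidGroup n ⧸ R.toSubgroup) ⋊[mulAutArrow] Equiv.Perm (Fin m) :=
    SemidirectProduct.map πF (MonoidHom.id _) (fun τ => by ext f a; rfl)
  let Φ := Ψ.comp (cableHom h)
  have : Finite ((Fin m → BraidGroup n ⧸ R.toSubgroup) ⋊[mulAutArrow] Equiv.Perm (Fin m)) :=
    Finite.of_equiv _ SemidirectProduct.equivProd.symm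
  let Θ : BraidGroup l →* (Fin m → BraidGroup n ⧸ R.toSubgroup) :=
    MonoidHom.pi fun i => π.comp (insertHom h i)
  refine ⟨.ofSubgroup Φ.ker, .ofSubgroup Θ.ker, fun i γ γ' ρ ρ' hγ hρ => ?_⟩
  have hγ : Φ γ = Φ γ' := by
    have : Φ (γ⁻¹ * γ') = 1 := hγ
    rwa [map_mul, map_inv, inv_mul_eq_one] at this
  have hρ : Θ ρ = Θ ρ' := by
    have : Θ (ρ⁻¹ * ρ') = 1 := hρ
    rwa [map_mul, map_inv, inv_mul_eq_one] at this
  have e1 : (cableHom h γ).right = (cableHom h γ').right :=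
    show (Φ γ).right = (Φ γ').right by rw [hγ]
  have e2 : ∀ a, π ((cableHom h γ).left a) = π ((cableHom h γ').left a) :=
    fun a => show (Φ γ).left a = (Φ γ').left a by rw [hγ]
  have e3 : π (insertHom h i ρ) = π (insertHom h i ρ') := congrFun hρ i
  refine QuotientGroup.eq.1 (show π (cable h i γ ρ) = π (cable h i γ' ρ') from ?_)
  rw [cable, cable, map_mul, map_mul, e1, e2, e3]

end Composition

/-- Families of finite quotients, one for each braid group, through which all the composition maps
`∘_i` into arity `n` from arities `m` and `l` smaller than `n` are defined. -/
def IndexFamily (n : ℕ) : Type :=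
  {P : (j : ℕ) → BraidQuot j // ∀ (m l : ℕ) (h : m + l = n + 1), 2 ≤ m → 2 ≤ l →
    ∀ i, Admissible h i (P m) (P l) (P n)}

instance (n : ℕ) : PartialOrder (IndexFamily n) :=
  inferInstanceAs (PartialOrder {P : (j : ℕ) → BraidQuot j // _})

/-- Any family of finite quotients is dominated by one in `IndexFamily n`. -/
theorem exists_indexFamily_le {n : ℕ} (P : (j : ℕ) → BraidQuot j) :
    ∃ P' : IndexFamily n, (∀ j, P'.1 j ≤ P j) ∧ P'.1 n = P n := by
  choose F G hFG using fun (m l : ℕ) (h : m + l = n + 1) => exists_admissible h (P n)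
  have hA : ∀ m, ∃ A : BraidQuot m, ∀ l h, A ≤ F m l h := by
    intro m
    by_cases hm : ∃ l, m + l = n + 1
    · obtain ⟨l, h⟩ := hm
      refine ⟨F m l h, fun l' h' => ?_⟩
      obtain rfl : l = l' := by omega
      exact le_rfl
    · exact ⟨P m, fun l h => (hm ⟨l, h⟩).elim⟩
  have hB : ∀ l, ∃ B : BraidQuot l, ∀ m h, B ≤ G m l h := by
    intro l
    by_cases hl : ∃ m, m + l = n + 1
    · obtain ⟨m, h⟩ := hl
      refine ⟨G m l h, fun m' h' => ?_⟩
      obtain rfl : m = m' := by omega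
      exact le_rfl
    · exact ⟨P l, fun m h => (hl ⟨m, h⟩).elim⟩
  choose A hA using hA
  choose B hB using hB
  refine ⟨⟨fun j => if j = n then P j else P j ⊓ A j ⊓ B j, ?_⟩, ?_, ?_⟩
  · intro m l h hm hl i
    simp only [if_pos, if_neg (show m ≠ n by omega), if_neg (show l ≠ n by omega)]
    exact (hFG m l h i).mono ((inf_le_left.trans inf_le_right).trans (hA m l h))
      (inf_le_right.trans (hB l m h))
  · intro j
    dsimp only
    split_ifs
    · exact le_rfl
    · exact inf_le_left.trans inf_le_left
  · simp

instance (n : ℕ) : Nonempty (IndexFamily n) :=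
  ⟨(exists_indexFamily_le fun _ => .ofSubgroup ⊤).choose⟩

instance (n : ℕ) : IsCodirectedOrder (IndexFamily n) :=
  ⟨fun P P' => by
    obtain ⟨P'', h, -⟩ := exists_indexFamily_le (n := n) fun j => P.1 j ⊓ P'.1 j
    exact ⟨P'', fun j => (h j).trans inf_le_left, fun j => (h j).trans inf_le_right⟩⟩

theorem transRingHom_single {k : Type*} [Field k] {n : ℕ} {N M : BraidQuot n} (h : N ≤ M)
    (x : BraidGroup n ⧸ N.toSubgroup) (a : k) :
    transRingHom k h (MonoidAlgebra.single x a) = MonoidAlgebra.single (quotMap h x) a := by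
  simp [transRingHom]

theorem transHom_circ {k : Type*} [Field k] {m l n : ℕ} {h : m + l = n + 1} {i : Fin m}
    {P P' : BraidQuot m} {Q Q' : BraidQuot l} {R R' : BraidQuot n} (hA : Admissible h i P Q R)
    (hA' : Admissible h i P' Q' R') (hP : P ≤ P') (hQ : Q ≤ Q') (hR : R ≤ R') (α : QuotAlg k P)
    (β : QuotAlg k Q) :
    transHom k hR (circ hA α β) = circ hA' (transHom k hP α) (transHom k hQ β) := by
  have key : ∀ x y, quotMap hR (cableQuot hA x y) = cableQuot hA' (quotMap hP x) (quotMap hQ y) := by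
    rintro ⟨x⟩ ⟨y⟩
    rfl
  have e1 : (transHom k hP α).coeff = α.coeff.mapDomain (quotMap hP) := rfl
  have e2 : (transHom k hQ β).coeff = β.coeff.mapDomain (quotMap hQ) := rfl
  rw [circ, circ, e1, e2, Finsupp.sum_mapDomain_index (by simp) (by
    intro b a a'
    simp [add_mul, Finsupp.sum_add])]
  change transRingHom k hR _ = _
  rw [Finsupp.sum, Finsupp.sum, map_sum]
  refine Finset.sum_congr rfl fun x _ => ?_
  rw [Finsupp.sum_mapDomain_index (by simp) (by intro b a a'; simp [mul_add])]
  rw [Finsupp.sum, Finsupp.sum, map_sum]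
  refine Finset.sum_congr rfl fun y _ => ?_
  rw [transRingHom_single, key]

section Indecomposables

variable {k : Type*} [Field k] (C M : BraidedSubseq k) {n : ℕ}

/-- The image in the group algebra of a finite quotient of the sum of the composition maps
`∘_i : Ind (C(m) ⊗ M(l)) → M(n)`, over `2 ≤ m ≤ n - 1`, `l = n - m + 1` and all `i`: the right
submodule generated by all compositions. -/
noncomputable def decomposables (P : IndexFamily n) :
    Submodule (BraidAlgOp k n) (QuotAlg k (P.1 n)) :=
  Submodule.span _ {x | ∃ (m l : ℕ) (h : m + l = n + 1) (hm : 2 ≤ m) (hl : 2 ≤ l) (i : Fin m),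
    ∃ α ∈ C.obj (P.1 m), ∃ β ∈ M.obj (P.1 l), x = circ (P.2 m l h hm hl i) α β}

/-- The value of the indecomposables at one index. -/
abbrev IndecObj (P : IndexFamily n) : Type _ :=
  M.obj (P.1 n) ⧸ (decomposables C M P).submoduleOf (M.obj (P.1 n))

theorem decomposables_map_mem {P P' : IndexFamily n} (h : P ≤ P') (x : QuotAlg k (P.1 n))
    (hx : x ∈ decomposables C M P) : transHom k (h n) x ∈ decomposables C M P' := by
  have : decomposables C M P ≤ (decomposables C M P').comap (transHom k (h n)) := by
    refine Submodule.span_le.2 ?_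
    rintro _ ⟨m, l, e, hm, hl, i, α, hα, β, hβ, rfl⟩
    exact Submodule.subset_span ⟨m, l, e, hm, hl, i, transHom k (h m) α, C.map_mem _ _ hα,
      transHom k (h l) β, M.map_mem _ _ hβ, transHom_circ _ _ _ _ _ _ _⟩
  exact this hx

/-- The indecomposables of `M` over `C` in arity `n`: the cokernel, as a pro-object, of the sum of
the composition maps `∘_i : Ind (C(m) ⊗ M(n-m+1)) → M(n)`. As the composition maps into the term
of `M(n)` at a finite quotient are defined on the terms of `C(m)` and `M(n-m+1)` at sufficiently
large finite quotients, the cokernel is indexed by the families in `IndexFamily n`. -/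
noncomputable def indec (n : ℕ) : IndexFamily n ⥤ ModuleCat (BraidAlgOp k n) where
  obj P := ModuleCat.of _ (IndecObj C M P)
  map {P P'} f := ModuleCat.ofHom (Submodule.mapQ _ _
    ((transHom k (f.le n)).restrict (M.map_mem (f.le n)))
    (fun x hx => decomposables_map_mem C M f.le x.1 hx))
  map_id P := by
    refine ModuleCat.hom_ext (LinearMap.ext fun x => ?_)
    obtain ⟨x, rfl⟩ := Submodule.mkQ_surjective _ x
    exact congrArg (Submodule.mkQ _) (Subtype.ext (transHom_refl k x.1))
  map_comp f g := by
    refine ModuleCat.hom_ext (LinearMap.ext fun x => ?_)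
    obtain ⟨x, rfl⟩ := Submodule.mkQ_surjective _ x
    exact congrArg (Submodule.mkQ _) (Subtype.ext (transHom_trans k (f.le n) (g.le n) x.1).symm)

/-- The map from the limit of `M(n)` to the limit of its indecomposables. -/
noncomputable def toIndec (v : ProLimit (M.pro n)) :
    ProLimit (indec C M n) :=
  ⟨fun P => (decomposables C M P).submoduleOf (M.obj (P.1 n)) |>.mkQ (v.term (P.1 n)), by
    intro P P' f
    exact congrArg (Submodule.mkQ _) (v.2 (homOfLE (f.le n)))⟩

end Indecomposables

/-- `e` is an idempotent that generates the right ideal `I` and is fixed by the antipode `g ↦ g⁻¹`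
of the group algebra. -/
def IsSymmIdempotentOf {k : Type*} [Field k] {n : ℕ} {N : BraidQuot n}
    (I : Submodule (BraidAlgOp k n) (QuotAlg k N)) (e : QuotAlg k N) : Prop :=
  e * e = e ∧ HopfAlgebra.antipode k e = e ∧ (I : Set (QuotAlg k N)) = {x | ∃ y, x = e * y}

/-- `g` is the element of the limit of `M(n)` whose term at each finite quotient is the unique
antipode-fixed idempotent that generates the right ideal given by `M(n)`. For the braided primitive
operad this is the braided Garsia idempotent. -/
def IsGarsiaElement {k : Type*} [Field k] (M : BraidedSubseq k) {n : ℕ}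
    (g : ProLimit (M.pro n)) : Prop :=
  ∀ (N : BraidQuot n) (e : QuotAlg k N),
    IsSymmIdempotentOf (M.obj N) e ↔ e = (show M.obj N from g.term N).1

/-!
On the rational group algebra of a finite group the standard bilinear form is positive definite, so
the orthogonal projection of `1` to a left ideal is an idempotent fixed by the antipode. Hence over
any field of characteristic zero the common right annihilator of rational elements of `k[Q]` is
`e k[Q]` for an antipode-fixed idempotent `e` such that `1 - e` lies in the left ideal generated by
these elements. Such an `e` is unique, hence compatible with the transition maps.

To see that the class of `e` modulo decomposables does not vanish, let `ζ` be a primitive `n`-th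
root of unity and consider the character `σ_j ↦ ζ` of all braid groups. It sends `𝕊_l` to the
`ζ`-factorial `[l]_ζ!` and `𝕊_{p, l - p}` to a `ζ`-binomial coefficient. For `l < n` these do not
vanish, so the character kills `BrPrim(l)` and `𝔚(l)` for `2 ≤ l < n`, hence all decomposables
in arity `n`. But `𝕊_n` and all `𝕊_{p, n - p}` with `0 < p < n` are sent to zero, so `1 - e` is
too, and the character takes the value `1` at `e`.
-/

section GroupAlgebra

open HopfAlgebra (antipode)

variable {F G : Type*} [CommSemiring F] [Group G]

theorem antipode_antipode_groupAlgebra (a : MonoidAlgebra F G) :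
    antipode F (antipode F a) = a := by
  induction a using MonoidAlgebra.induction_linear with
  | zero => simp
  | add x y hx hy => rw [map_add, map_add, hx, hy]
  | single g r => simp

theorem antipode_mapRingHom {E : Type*} [CommSemiring E] (f : F →+* E) (a : MonoidAlgebra F G) :
    antipode E (MonoidAlgebra.mapRingHom G f a) = MonoidAlgebra.mapRingHom G f (antipode F a) := by
  induction a using MonoidAlgebra.induction_linear with
  | zero => simp
  | add x y hx hy => simp only [map_add, hx, hy]
  | single g r => simp

theorem antipode_mapDomainRingHom {H : Type*} [Group H] (f : G →* H) (a : MonoidAlgebra F G) :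
    antipode F (MonoidAlgebra.mapDomainRingHom F f a) =
      MonoidAlgebra.mapDomainRingHom F f (antipode F a) := by
  induction a using MonoidAlgebra.induction_linear with
  | zero => simp
  | add x y hx hy => simp only [map_add, hx, hy]
  | single g r => simp

theorem coeff_antipode (a : MonoidAlgebra F G) (g : G) : (antipode F a).coeff g = a.coeff g⁻¹ := by
  classical
  induction a using MonoidAlgebra.induction_linear with
  | zero => simp
  | add x y hx hy => simp [hx, hy]
  | single h r => simp [Finsupp.single_apply, inv_eq_iff_eq_inv]

theorem coeff_mul_one_comm (a b : MonoidAlgebra F G) : (a * b).coeff 1 = (b * a).coeff 1 := by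
  rw [MonoidAlgebra.coeff_mul_apply_right, MonoidAlgebra.coeff_mul_apply_left]
  simp only [one_mul, mul_one, mul_comm]

/-- The standard symmetric bilinear form `∑ g, a g * b g` on a group algebra, written through the
antipode so that left multiplication by `antipode a` is visibly adjoint to that by `a`. -/
noncomputable def coeffForm (F G : Type*) [CommSemiring F] [Group G] :
    LinearMap.BilinForm F (MonoidAlgebra F G) :=
  LinearMap.mk₂ F (fun a b => (antipode F a * b).coeff 1)
    (by simp [add_mul]) (by simp) (by simp [mul_add]) (by simp)

theorem coeffForm_apply (a b : MonoidAlgebra F G) :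
    coeffForm F G a b = (antipode F a * b).coeff 1 := rfl

theorem coeffForm_eq_sum (a b : MonoidAlgebra F G) :
    coeffForm F G a b = b.coeff.sum fun g r => a.coeff g * r := by
  simp only [coeffForm_apply, MonoidAlgebra.coeff_mul_apply_right, one_mul, coeff_antipode, inv_inv]

theorem coeffForm_mul_left (a b c : MonoidAlgebra F G) :
    coeffForm F G (a * b) c = coeffForm F G b (antipode F a * c) := by
  simp only [coeffForm_apply, HopfAlgebra.antipode_mul_antidistrib, mul_assoc]

theorem coeffForm_mul_right (a b c : MonoidAlgebra F G) :
    coeffForm F G (a * b) c = coeffForm F G a (c * antipode F b) := by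
  rw [coeffForm_apply, coeffForm_apply, HopfAlgebra.antipode_mul_antidistrib, mul_assoc,
    coeff_mul_one_comm, mul_assoc]

theorem isSymm_coeffForm : (coeffForm F G).IsSymm := by
  refine ⟨fun a b => ?_⟩
  have h_inv := coeff_antipode (antipode F a * b) 1
  rwa [inv_one, HopfAlgebra.antipode_mul_antidistrib, antipode_antipode_groupAlgebra,
    eq_comm] at h_inv

theorem eq_of_antipode_eq_of_mul_eq {e e' : MonoidAlgebra F G} (he : antipode F e = e)
    (he' : antipode F e' = e') (h : e * e' = e') (h' : e' * e = e) : e = e' := by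
  have := congrArg (antipode F) h'
  rwa [HopfAlgebra.antipode_mul_antidistrib, he, he', h, eq_comm] at this

end GroupAlgebra

theorem mul_eq_zero_of_mem_span {A : Type*} [Semiring A] {X : Set A} {a y : A}
    (hy : ∀ x ∈ X, x * y = 0) (ha : a ∈ Ideal.span X) : a * y = 0 := by
  induction ha using Submodule.span_induction with
  | mem x hx => exact hy x hx
  | zero => exact zero_mul y
  | add a b _ _ ha hb => rw [add_mul, ha, hb, add_zero]
  | smul c a _ ha => rw [smul_eq_mul, mul_assoc, ha, mul_zero]

section AnnihilatorProjection

open HopfAlgebra (antipode)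

/-- `e` is an antipode-fixed idempotent that generates the common right annihilator of the elements
of `X`. Asking for `1 - e` to lie in the left ideal generated by `X`, rather than for every element
`y` with `X * y = 0` to be in `e k[G]`, makes the notion stable under change of ring and group. -/
structure IsAnnihilatorProjection {F G : Type*} [CommRing F] [Group G]
    (X : Set (MonoidAlgebra F G)) (e : MonoidAlgebra F G) : Prop where
  antipode_eq : antipode F e = e
  mul_eq_zero : ∀ x ∈ X, x * e = 0
  one_sub_mem : 1 - e ∈ Ideal.span X

section Existence

variable {F G : Type*} [Field F] [LinearOrder F] [IsStrictOrderedRing F] [Group G]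

theorem eq_zero_of_coeffForm_self_eq_zero {a : MonoidAlgebra F G} (h : coeffForm F G a a = 0) :
    a = 0 := by
  rw [coeffForm_eq_sum, Finsupp.sum,
    Finset.sum_eq_zero_iff_of_nonneg fun g _ => mul_self_nonneg _] at h
  ext g
  by_contra hg
  exact hg (mul_self_eq_zero.1 (h g (Finsupp.mem_support_iff.2 hg)))

variable [Finite G]

theorem isCompl_orthogonal_coeffForm (W : Submodule F (MonoidAlgebra F G)) :
    IsCompl W ((coeffForm F G).orthogonal W) := by
  have : FiniteDimensional F (MonoidAlgebra F G) :=
    Module.Finite.equiv (MonoidAlgebra.coeffLinearEquiv F).symm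
  refine LinearMap.BilinForm.isCompl_orthogonal_of_restrict_nondegenerate
    isSymm_coeffForm.isRefl ⟨fun a ha => ?_, fun a ha => ?_⟩ <;>
  exact Subtype.ext (eq_zero_of_coeffForm_self_eq_zero (ha a))

/-- The orthogonal projection of `1` to `J` is such an element. -/
theorem exists_mem_ideal_antipode_eq_mul_eq_self (J : Ideal (MonoidAlgebra F G)) :
    ∃ f ∈ J, antipode F f = f ∧ ∀ a ∈ J, a * f = a := by
  have hJ := isCompl_orthogonal_coeffForm (J.restrictScalars F)
  obtain ⟨f, hf, e, he, hfe⟩ := Submodule.mem_sup.1 (hJ.sup_eq_top ▸ Submodule.mem_top (x := 1))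
  have he_orth : ∀ a ∈ J, coeffForm F G a e = 0 := he
  have he_eq : e = 1 - f := eq_sub_of_add_eq' hfe
  refine ⟨f, hf, ?_, fun a ha => ?_⟩
  · have h_mul : antipode F f = f * antipode F f := by
      have : e * antipode F f = 0 := by
        refine eq_zero_of_coeffForm_self_eq_zero ?_
        rw [← coeffForm_mul_right]
        exact he_orth _ (J.mul_mem_left _ hf)
      rwa [he_eq, sub_mul, one_mul, sub_eq_zero] at this
    have h_mul' := congrArg (antipode F) h_mul
    rw [HopfAlgebra.antipode_mul_antidistrib, antipode_antipode_groupAlgebra, ← h_mul] at h_mul'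
    exact h_mul'.symm
  · have h_mem : a * e ∈ J := by
      rw [he_eq, mul_sub, mul_one]
      exact J.sub_mem ha (J.mul_mem_left a hf)
    have h_zero : a * e = 0 := by
      refine eq_zero_of_coeffForm_self_eq_zero ?_
      rw [coeffForm_mul_left, isSymm_coeffForm.eq]
      exact he_orth _ (J.mul_mem_left _ h_mem)
    rwa [he_eq, mul_sub, mul_one, sub_eq_zero, eq_comm] at h_zero

theorem exists_isAnnihilatorProjection (X : Set (MonoidAlgebra F G)) :
    ∃ e, IsAnnihilatorProjection X e := by
  obtain ⟨f, hf, h_antipode, h_mul⟩ := exists_mem_ideal_antipode_eq_mul_eq_self (Ideal.span X)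
  refine ⟨1 - f, ?_, fun x hx => ?_, by rwa [sub_sub_cancel]⟩
  · rw [map_sub, HopfAlgebra.antipode_one, h_antipode]
  · rw [mul_sub, mul_one, h_mul x (Ideal.subset_span hx), sub_self]

end Existence

variable {F G : Type*} [CommRing F] [Group G] {X : Set (MonoidAlgebra F G)}
  {e y : MonoidAlgebra F G}

namespace IsAnnihilatorProjection

theorem mul_eq_self (he : IsAnnihilatorProjection X e) (hy : ∀ x ∈ X, x * y = 0) : e * y = y := by
  have := mul_eq_zero_of_mem_span hy he.one_sub_mem
  rwa [sub_mul, one_mul, sub_eq_zero, eq_comm] at this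

theorem mul_self (he : IsAnnihilatorProjection X e) : e * e = e :=
  he.mul_eq_self he.mul_eq_zero

theorem setOf_mul_eq_zero (he : IsAnnihilatorProjection X e) :
    {y | ∀ x ∈ X, x * y = 0} = {y | ∃ z, y = e * z} := by
  ext y
  refine ⟨fun hy => ⟨y, (he.mul_eq_self hy).symm⟩, ?_⟩
  rintro ⟨z, rfl⟩ x hx
  rw [← mul_assoc, he.mul_eq_zero x hx, zero_mul]

theorem eq {e' : MonoidAlgebra F G} (he : IsAnnihilatorProjection X e)
    (he' : IsAnnihilatorProjection X e') : e = e' :=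
  eq_of_antipode_eq_of_mul_eq he.antipode_eq he'.antipode_eq
    (he.mul_eq_self he'.mul_eq_zero) (he'.mul_eq_self he.mul_eq_zero)

theorem map {E H : Type*} [CommRing E] [Group H] (he : IsAnnihilatorProjection X e)
    (f : MonoidAlgebra F G →+* MonoidAlgebra E H)
    (hf : ∀ a, antipode E (f a) = f (antipode F a)) : IsAnnihilatorProjection (f '' X) (f e) where
  antipode_eq := by rw [hf, he.antipode_eq]
  mul_eq_zero := by
    rintro _ ⟨x, hx, rfl⟩
    rw [← map_mul, he.mul_eq_zero x hx, map_zero]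
  one_sub_mem := by
    rw [← map_one f, ← map_sub, ← Ideal.map_span]
    exact Ideal.mem_map_of_mem f he.one_sub_mem

theorem map_eq_one {E : Type*} [Ring E] (he : IsAnnihilatorProjection X e)
    (φ : MonoidAlgebra F G →+* E) (hφ : ∀ x ∈ X, φ x = 0) : φ e = 1 := by
  have h_le : Ideal.span X ≤ RingHom.ker φ := Ideal.span_le.2 hφ
  have := RingHom.mem_ker.1 (h_le he.one_sub_mem)
  rwa [map_sub, map_one, sub_eq_zero, eq_comm] at this

end IsAnnihilatorProjection

end AnnihilatorProjection

section ProObjects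

universe u v w

variable {A : Type u} [Ring A] {J : Type v} [Preorder J] [IsCofiltered J]
  {V : J ⥤ ModuleCat.{w} A} {v : ProLimit V}

theorem not_isProZero_of_term_ne_zero {j : J} (hv : v.term j ≠ 0) : ¬ IsProZero V := by
  intro hV
  obtain ⟨i, f, hf⟩ := hV j
  have h_term : V.map f (v.term i) = v.term j := v.2 f
  exact hv (by rw [← h_term, hf]; rfl)

theorem isProGenerator_of_forall_span_eq_top (hv : ∀ j, Submodule.span A {v.term j} = ⊤) :
    IsProGenerator V v :=
  ⟨Set.univ, fun j => ⟨j, trivial, le_rfl⟩, fun j _ => hv j⟩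

end ProObjects

theorem span_singleton_map_eq_top {A V W : Type*} [Ring A] [AddCommGroup V] [AddCommGroup W]
    [Module A V] [Module A W] (f : V →ₗ[A] W) (hf : Function.Surjective f) {v : V}
    (hv : Submodule.span A {v} = ⊤) : Submodule.span A {f v} = ⊤ := by
  rw [← Set.image_singleton, ← Submodule.map_span, hv, Submodule.map_top,
    LinearMap.range_eq_top.2 hf]

section GarsiaElement

variable {k : Type*} [Field k] {n : ℕ} {N : BraidQuot n}

theorem toQuotAlg_surjective (N : BraidQuot n) : Function.Surjective (toQuotAlg k N) := by
  intro v
  induction v using MonoidAlgebra.induction_linear with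
  | zero => exact ⟨0, map_zero _⟩
  | add x y hx hy =>
    obtain ⟨a, rfl⟩ := hx
    obtain ⟨b, rfl⟩ := hy
    exact ⟨a + b, map_add _ _ _⟩
  | single g r =>
    obtain ⟨g, rfl⟩ := QuotientGroup.mk'_surjective _ g
    exact ⟨MonoidAlgebra.single g r, by simp [toQuotAlg]⟩

namespace IsSymmIdempotentOf

variable {I : Submodule (BraidAlgOp k n) (QuotAlg k N)} {e f : QuotAlg k N}

theorem mem_iff (he : IsSymmIdempotentOf I e) {v : QuotAlg k N} : v ∈ I ↔ e * v = v := by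
  rw [← SetLike.mem_coe, he.2.2]
  refine ⟨?_, fun hv => ⟨v, hv.symm⟩⟩
  rintro ⟨y, rfl⟩
  rw [← mul_assoc, he.1]

theorem mem (he : IsSymmIdempotentOf I e) : e ∈ I :=
  he.mem_iff.2 he.1

theorem eq (he : IsSymmIdempotentOf I e) (hf : IsSymmIdempotentOf I f) : e = f :=
  eq_of_antipode_eq_of_mul_eq he.2.1 hf.2.1 (he.mem_iff.1 hf.mem) (hf.mem_iff.1 he.mem)

theorem span_eq_top (he : IsSymmIdempotentOf I e) :
    Submodule.span (BraidAlgOp k n) {(⟨e, he.mem⟩ : I)} = ⊤ := by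
  refine eq_top_iff.2 fun ⟨v, hv⟩ _ => ?_
  obtain ⟨b, rfl⟩ := toQuotAlg_surjective N v
  exact Submodule.mem_span_singleton.2 ⟨op b, Subtype.ext (he.mem_iff.1 hv)⟩

end IsSymmIdempotentOf

namespace BraidedSubseq

variable {M : BraidedSubseq k}

theorem exists_proLimit_of_isSymmIdempotentOf {e : ∀ N : BraidQuot n, QuotAlg k N}
    (he : ∀ N, IsSymmIdempotentOf (M.obj N) (e N))
    (h_trans : ∀ {N N' : BraidQuot n} (h : N ≤ N'), transRingHom k h (e N) = e N') :
    ∃ g : ProLimit (M.pro n), IsGarsiaElement M g ∧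
      (∀ N, Submodule.span (BraidAlgOp k n) {g.term N} = ⊤) ∧
      ∀ N, (show M.obj N from g.term N).1 = e N :=
  ⟨⟨fun N => (⟨e N, (he N).mem⟩ : M.obj N), fun f => Subtype.ext (h_trans f.le)⟩,
    fun N _ => ⟨fun h => h.eq (he N), fun h => h ▸ he N⟩, fun N => (he N).span_eq_top,
    fun _ => rfl⟩

theorem mapRingHom_symmetrizer {E F : Type*} [Field E] [Field F] (f : E →+* F) (n : ℕ) :
    MonoidAlgebra.mapRingHom _ f (symmetrizer E n) = symmetrizer F n := by
  simp [symmetrizer]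

theorem mapRingHom_unshuffleSum {E F : Type*} [Field E] [Field F] (f : E →+* F) (n p : ℕ) :
    MonoidAlgebra.mapRingHom _ f (unshuffleSum E n p) = unshuffleSum F n p := by
  simp [unshuffleSum]

theorem mem_woronowicz_obj {v : QuotAlg k N} :
    v ∈ (woronowicz k).obj N ↔ toQuotAlg k N (symmetrizer k n) * v = 0 :=
  LinearMap.mem_ker

theorem mem_brPrim_obj (hn : 2 ≤ n) {v : QuotAlg k N} :
    v ∈ (brPrim k).obj N ↔ ∀ p ∈ Set.Ioo 0 n, toQuotAlg k N (unshuffleSum k n p) * v = 0 := by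
  simp only [brPrim, if_neg (show ¬ n ≤ 1 by omega), Submodule.mem_iInf, LinearMap.mem_ker,
    Set.mem_Ioo]
  rfl

section Indecomposables

variable (C : BraidedSubseq k) {g : ProLimit (M.pro n)} {P : IndexFamily n}

theorem toIndec_term_eq_zero_iff :
    (toIndec C M g).term P = 0 ↔ (show M.obj (P.1 n) from g.term (P.1 n)).1 ∈
      decomposables C M P :=
  Submodule.Quotient.mk_eq_zero _

theorem term_ne_zero_of_toIndec_term_ne_zero (h : (toIndec C M g).term P ≠ 0) :
    g.term (P.1 n) ≠ 0 := by
  refine fun hg => h ((toIndec_term_eq_zero_iff C).2 ?_)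
  rw [hg]
  exact zero_mem _

theorem span_toIndec_term_eq_top (hg : ∀ N, Submodule.span (BraidAlgOp k n) {g.term N} = ⊤)
    (P : IndexFamily n) : Submodule.span (BraidAlgOp k n) {(toIndec C M g).term P} = ⊤ :=
  span_singleton_map_eq_top _ (Submodule.mkQ_surjective _) (hg (P.1 n))

end Indecomposables

section RationalAnnihilator

variable [CharZero k]

/-- The image in `k[Q]` of an element of the rational group algebra of the braid group. The defining
elements of the operations studied here are rational, and it is over `ℚ` that the standard bilinear
form on the group algebra of `Q` is positive definite. -/
noncomputable def ratToQuotAlg (k : Type*) [Field k] [CharZero k] (N : BraidQuot n) :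
    MonoidAlgebra ℚ (BraidGroup n) →+* QuotAlg k N :=
  (toQuotAlg k N).comp (MonoidAlgebra.mapRingHom _ (algebraMap ℚ k))

theorem ratToQuotAlg_eq_mapRingHom (N : BraidQuot n) (x : MonoidAlgebra ℚ (BraidGroup n)) :
    ratToQuotAlg k N x = MonoidAlgebra.mapRingHom _ (algebraMap ℚ k) (toQuotAlg ℚ N x) :=
  (DFunLike.congr_fun (MonoidAlgebra.mapRingHom_comp_mapDomainRingHom (algebraMap ℚ k)
    (QuotientGroup.mk' N.toSubgroup)) x).symm

theorem transRingHom_ratToQuotAlg {N N' : BraidQuot n} (h : N ≤ N')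
    (x : MonoidAlgebra ℚ (BraidGroup n)) :
    transRingHom k h (ratToQuotAlg k N x) = ratToQuotAlg k N' x :=
  transRingHom_toQuotAlg k h _

/-- `M(n)` is the common right annihilator of a set `X` of elements of the rational group algebra of
the braid group. -/
def IsRationalAnnihilator (M : BraidedSubseq k) (X : Set (MonoidAlgebra ℚ (BraidGroup n))) : Prop :=
  ∀ (N : BraidQuot n) (v : QuotAlg k N), v ∈ M.obj N ↔ ∀ x ∈ X, ratToQuotAlg k N x * v = 0

variable {X : Set (MonoidAlgebra ℚ (BraidGroup n))}

theorem exists_isAnnihilatorProjection_ratToQuotAlg (X : Set (MonoidAlgebra ℚ (BraidGroup n)))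
    (N : BraidQuot n) : ∃ e, IsAnnihilatorProjection (ratToQuotAlg k N '' X) e := by
  obtain ⟨e, he⟩ := exists_isAnnihilatorProjection (toQuotAlg ℚ N '' X)
  have h_map := he.map (MonoidAlgebra.mapRingHom _ (algebraMap ℚ k)) (antipode_mapRingHom _)
  simp only [Set.image_image, ← ratToQuotAlg_eq_mapRingHom] at h_map
  exact ⟨_, h_map⟩

namespace IsRationalAnnihilator

variable (hM : M.IsRationalAnnihilator X)
include hM

theorem isSymmIdempotentOf {e : QuotAlg k N}
    (he : IsAnnihilatorProjection (ratToQuotAlg k N '' X) e) :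
    IsSymmIdempotentOf (M.obj N) e := by
  refine ⟨he.mul_self, he.antipode_eq, ?_⟩
  rw [← he.setOf_mul_eq_zero]
  ext v
  simp only [SetLike.mem_coe, hM N v, Set.forall_mem_image, Set.mem_ofPred_eq]

theorem exists_proLimit : ∃ g : ProLimit (M.pro n), IsGarsiaElement M g ∧
    (∀ N, Submodule.span (BraidAlgOp k n) {g.term N} = ⊤) ∧
    ∀ N, IsAnnihilatorProjection (ratToQuotAlg k N '' X) (show M.obj N from g.term N).1 := by
  choose e he using exists_isAnnihilatorProjection_ratToQuotAlg (k := k) X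
  have h_trans : ∀ {N N' : BraidQuot n} (h : N ≤ N'), transRingHom k h (e N) = e N' := by
    intro N N' h
    have h_map := (he N).map (transRingHom k h) (antipode_mapDomainRingHom _)
    simp only [Set.image_image, transRingHom_ratToQuotAlg] at h_map
    exact h_map.eq (he N')
  obtain ⟨g, hg, h_span, h_term⟩ :=
    exists_proLimit_of_isSymmIdempotentOf (fun N => hM.isSymmIdempotentOf (he N)) h_trans
  exact ⟨g, hg, h_span, fun N => h_term N ▸ he N⟩

theorem exists_garsia_generator (C : BraidedSubseq k) {K : Type*} [Ring K] [Nontrivial K]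
    (P : IndexFamily n) (φ : QuotAlg k (P.1 n) →+* K)
    (hφ : ∀ x ∈ X, φ (ratToQuotAlg k _ x) = 0) (h_dec : ∀ v ∈ decomposables C M P, φ v = 0) :
    ∃ g : ProLimit (M.pro n), IsGarsiaElement M g ∧ IsProGenerator (M.pro n) g ∧
      IsProGenerator (indec C M n) (toIndec C M g) ∧ (toIndec C M g).term P ≠ 0 := by
  obtain ⟨g, hg, h_span, h_proj⟩ := hM.exists_proLimit
  refine ⟨g, hg, isProGenerator_of_forall_span_eq_top h_span,
    isProGenerator_of_forall_span_eq_top (span_toIndec_term_eq_top C h_span), fun h_zero => ?_⟩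
  have h_one := (h_proj (P.1 n)).map_eq_one φ (Set.forall_mem_image.2 hφ)
  rw [h_dec _ ((toIndec_term_eq_zero_iff C).1 h_zero)] at h_one
  exact zero_ne_one h_one

end IsRationalAnnihilator

theorem ratToQuotAlg_symmetrizer (N : BraidQuot n) :
    ratToQuotAlg k N (symmetrizer ℚ n) = toQuotAlg k N (symmetrizer k n) := by
  rw [ratToQuotAlg, RingHom.comp_apply, mapRingHom_symmetrizer]

theorem ratToQuotAlg_unshuffleSum (N : BraidQuot n) (p : ℕ) :
    ratToQuotAlg k N (unshuffleSum ℚ n p) = toQuotAlg k N (unshuffleSum k n p) := by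
  rw [ratToQuotAlg, RingHom.comp_apply, mapRingHom_unshuffleSum]

theorem isRationalAnnihilator_woronowicz (k : Type*) [Field k] [CharZero k] (n : ℕ) :
    (woronowicz k).IsRationalAnnihilator {symmetrizer ℚ n} := by
  intro N v
  rw [mem_woronowicz_obj, ← ratToQuotAlg_symmetrizer]
  simp only [Set.mem_singleton_iff, forall_eq]

theorem isRationalAnnihilator_brPrim (k : Type*) [Field k] [CharZero k] (hn : 2 ≤ n) :
    (brPrim k).IsRationalAnnihilator (unshuffleSum ℚ n '' Set.Ioo 0 n) := by
  intro N v
  rw [mem_brPrim_obj hn, Set.forall_mem_image]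
  simp only [ratToQuotAlg_unshuffleSum]

end RationalAnnihilator

end BraidedSubseq

end GarsiaElement

section Inversions

variable {n : ℕ} {α : Type*} [LinearOrder α]

/-- The number of inversions of a finite sequence, in particular of a permutation of `Fin n`. -/
def invCount (f : Fin n → α) : ℕ :=
  Finset.card {x : Fin n × Fin n | x.1 < x.2 ∧ f x.2 < f x.1}

theorem invCount_eq_sum (f : Fin n → α) :
    invCount f = ∑ a, ∑ b, if a < b ∧ f b < f a then 1 else 0 := by
  rw [invCount, Finset.card_filter, Fintype.sum_prod_type]

theorem invCount_eq_zero_iff {f : Fin n → α} : invCount f = 0 ↔ Monotone f := by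
  rw [invCount, Finset.card_eq_zero, Finset.filter_eq_empty_iff]
  refine ⟨fun h a b hab => ?_, ?_⟩
  · rcases hab.eq_or_lt with rfl | hab
    · exact le_rfl
    · exact not_lt.1 fun hf => h (Finset.mem_univ (a, b)) ⟨hab, hf⟩
  · rintro hf ⟨a, b⟩ - ⟨hab, hfab⟩
    exact (hf hab.le).not_gt hfab

theorem invCount_comp_of_strictMono {β : Type*} [LinearOrder β] {g : α → β} (hg : StrictMono g)
    (f : Fin n → α) : invCount (g ∘ f) = invCount f := by
  simp only [invCount, Function.comp_apply, hg.lt_iff_lt]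

theorem invCount_comp_perm (f : Fin n → α) (σ : Equiv.Perm (Fin n)) : invCount (f ∘ σ) =
    Finset.card {x : Fin n × Fin n | σ⁻¹ x.1 < σ⁻¹ x.2 ∧ f x.2 < f x.1} :=
  Finset.card_equiv (σ.prodCongr σ) (by simp)

theorem invCount_inv (w : Equiv.Perm (Fin n)) : invCount ⇑w⁻¹ = invCount ⇑w := by
  rw [← Function.id_comp ⇑w⁻¹, invCount_comp_perm, inv_inv, invCount]
  exact Finset.card_equiv (Equiv.prodComm _ _) (by simp [and_comm])

theorem adjSwap_mul_self (n j : ℕ) : adjSwap n j * adjSwap n j = 1 :=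
  mul_eq_one_iff_eq_inv.2 (adjSwap_inv n j).symm

theorem adjSwap_left {j : ℕ} (h : j + 1 < n) : adjSwap n j ⟨j, by omega⟩ = ⟨j + 1, h⟩ := by
  simp [Fin.ext_iff, adjSwap_val h]

theorem adjSwap_right {j : ℕ} (h : j + 1 < n) : adjSwap n j ⟨j + 1, h⟩ = ⟨j, by omega⟩ := by
  simp [Fin.ext_iff, adjSwap_val h]

theorem adjSwap_lt_adjSwap_iff {j : ℕ} (h : j + 1 < n) (a b : Fin n) :
    adjSwap n j a < adjSwap n j b ↔ (a = ⟨j + 1, h⟩ ∧ b = ⟨j, by omega⟩) ∨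
      (a < b ∧ ¬ (a = ⟨j, by omega⟩ ∧ b = ⟨j + 1, h⟩)) := by
  simp only [Fin.lt_def, Fin.ext_iff, adjSwap_val h]
  split_ifs <;> omega

theorem invCount_comp_adjSwap {j : ℕ} (h : j + 1 < n) {f : Fin n → α}
    (hf : f ⟨j, by omega⟩ < f ⟨j + 1, h⟩) : invCount (f ∘ adjSwap n j) = invCount f + 1 := by
  have h_insert : (Finset.univ.filter fun x : Fin n × Fin n =>
        adjSwap n j x.1 < adjSwap n j x.2 ∧ f x.2 < f x.1) =
      insert (⟨j + 1, h⟩, ⟨j, by omega⟩)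
        (Finset.univ.filter fun x : Fin n × Fin n => x.1 < x.2 ∧ f x.2 < f x.1) := by
    ext ⟨a, b⟩
    simp only [Finset.mem_filter, Finset.mem_univ, true_and, Finset.mem_insert, Prod.mk.injEq,
      adjSwap_lt_adjSwap_iff h]
    constructor
    · rintro ⟨hab | ⟨hab, -⟩, hfab⟩
      · exact .inl hab
      · exact .inr ⟨hab, hfab⟩
    · rintro (⟨rfl, rfl⟩ | ⟨hab, hfab⟩)
      · exact ⟨.inl ⟨rfl, rfl⟩, hf⟩
      · refine ⟨.inr ⟨hab, ?_⟩, hfab⟩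
        rintro ⟨rfl, rfl⟩
        exact lt_asymm hf hfab
  rw [invCount_comp_perm, adjSwap_inv, h_insert, Finset.card_insert_of_notMem (by simp), invCount]

theorem invCount_comp_adjSwap_of_gt {j : ℕ} (h : j + 1 < n) {f : Fin n → α}
    (hf : f ⟨j + 1, h⟩ < f ⟨j, by omega⟩) : invCount (f ∘ adjSwap n j) + 1 = invCount f := by
  rw [← invCount_comp_adjSwap h, Function.comp_assoc, ← Equiv.Perm.coe_mul, adjSwap_mul_self,
    Equiv.Perm.coe_one, Function.comp_id]
  simpa only [Function.comp_apply, adjSwap_left h, adjSwap_right h] using hf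

theorem invCount_mul_adjSwap_le {j : ℕ} (h : j + 1 < n) (w : Equiv.Perm (Fin n)) :
    invCount ⇑(w * adjSwap n j) ≤ invCount ⇑w + 1 := by
  rw [Equiv.Perm.coe_mul]
  rcases lt_trichotomy (w ⟨j, by omega⟩) (w ⟨j + 1, h⟩) with hw | hw | hw
  · exact (invCount_comp_adjSwap h hw).le
  · simp at hw
  · have := invCount_comp_adjSwap_of_gt h hw
    omega

theorem invCount_prod_le_length (l : List (Fin (n - 1))) :
    invCount ⇑(l.map fun j : Fin (n - 1) => adjSwap n j).prod ≤ l.length := by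
  induction l using List.reverseRecOn with
  | nil => exact (invCount_eq_zero_iff.2 monotone_id).le
  | append_singleton l j ih =>
    rw [List.map_append, List.prod_append, List.map_singleton, List.prod_singleton,
      List.length_append, List.length_singleton]
    exact (invCount_mul_adjSwap_le (by omega) _).trans (Nat.add_le_add_right ih 1)

theorem exists_apply_succ_lt_of_not_monotone {f : Fin n → α} (hf : ¬ Monotone f) :
    ∃ (j : ℕ) (h : j + 1 < n), f ⟨j + 1, h⟩ < f ⟨j, by omega⟩ := by
  cases n with
  | zero => exact (hf fun a => a.elim0).elim
  | succ n =>
    obtain ⟨i, hi⟩ := not_forall.1 (mt Fin.monotone_iff_le_succ.2 hf)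
    exact ⟨i, by omega, not_le.1 hi⟩

theorem exists_word_length_eq_invCount (w : Equiv.Perm (Fin n)) :
    ∃ l : List (Fin (n - 1)),
      (l.map fun j : Fin (n - 1) => adjSwap n j).prod = w ∧ l.length = invCount ⇑w := by
  induction hm : invCount ⇑w generalizing w with
  | zero => exact ⟨[], ((Equiv.Perm.monotone_iff w).1 (invCount_eq_zero_iff.1 hm)).symm, rfl⟩
  | succ m ih =>
    obtain ⟨j, h, hw⟩ := exists_apply_succ_lt_of_not_monotone (f := ⇑w)
      (mt invCount_eq_zero_iff.2 (by omega))
    have h_count := invCount_comp_adjSwap_of_gt h hw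
    obtain ⟨l, h_prod, h_length⟩ := ih (w * adjSwap n j) (by rw [Equiv.Perm.coe_mul]; omega)
    refine ⟨l ++ [⟨j, by omega⟩], ?_, by simp [h_length]⟩
    rw [List.map_append, List.prod_append, h_prod, List.map_singleton, List.prod_singleton,
      mul_assoc, adjSwap_mul_self, mul_one]

/-- The coercion of a list of `Fin m` to a list of `ℕ`, as it elaborates in `IsReducedWord` and in
`matsumotoLift`. -/
theorem bind_pure_val_eq_map_val {m : ℕ} (l : List (Fin m)) :
    (do let a ← l; pure (a : ℕ)) = l.map Fin.val := by
  simp [List.map_eq_flatMap]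

theorem IsReducedWord.length_eq {w : Equiv.Perm (Fin n)} {l : List (Fin (n - 1))}
    (h : IsReducedWord w l) : l.length = invCount ⇑w := by
  obtain ⟨l', h_prod, h_length⟩ := exists_word_length_eq_invCount w
  simp only [IsReducedWord, bind_pure_val_eq_map_val, List.map_map, Function.comp_def] at h
  exact le_antisymm (h_length ▸ h.2 l' h_prod) (h.1 ▸ invCount_prod_le_length l)

end Inversions

section Shuffles

variable {p r : ℕ}

theorem invCount_add {α : Type*} [LinearOrder α] (f : Fin (p + r) → α) : invCount f =
    invCount (f ∘ Fin.castAdd r) + invCount (f ∘ Fin.natAdd p) +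
      Finset.card {x : Fin p × Fin r | f (Fin.natAdd p x.2) < f (Fin.castAdd r x.1)} := by
  have h_lt : ∀ (a : Fin p) (b : Fin r), Fin.castAdd r a < Fin.natAdd p b := fun a b => by
    rw [Fin.lt_def, Fin.val_castAdd, Fin.val_natAdd]
    omega
  have h_cast : ∀ a b : Fin p, Fin.castAdd r a < Fin.castAdd r b ↔ a < b :=
    fun a b => (Fin.strictMono_castAdd r).lt_iff_lt
  simp only [invCount_eq_sum, Fin.sum_univ_add, Finset.sum_add_distrib, h_lt, (h_lt _ _).not_gt,
    h_cast, Fin.natAdd_lt_natAdd_iff, true_and, false_and, if_false, Finset.sum_const_zero,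
    Finset.card_filter, Fintype.sum_prod_type, Function.comp_apply]
  ring

/-- The juxtaposition of two permutations, that is, the block sum `S_p × S_r → S_{p + r}`. -/
def juxtPerm (u : Equiv.Perm (Fin p)) (v : Equiv.Perm (Fin r)) : Equiv.Perm (Fin (p + r)) :=
  finSumFinEquiv.permCongr (Equiv.Perm.sumCongr u v)

theorem juxtPerm_castAdd (u : Equiv.Perm (Fin p)) (v : Equiv.Perm (Fin r)) (a : Fin p) :
    juxtPerm u v (Fin.castAdd r a) = Fin.castAdd r (u a) := by
  simp [juxtPerm, Equiv.permCongr_apply]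

theorem juxtPerm_natAdd (u : Equiv.Perm (Fin p)) (v : Equiv.Perm (Fin r)) (a : Fin r) :
    juxtPerm u v (Fin.natAdd p a) = Fin.natAdd p (v a) := by
  simp [juxtPerm, Equiv.permCongr_apply]

theorem mul_juxtPerm_comp_castAdd (w : Equiv.Perm (Fin (p + r))) (u : Equiv.Perm (Fin p))
    (v : Equiv.Perm (Fin r)) : ⇑(w * juxtPerm u v) ∘ Fin.castAdd r = (w ∘ Fin.castAdd r) ∘ u :=
  funext fun a => congrArg w (juxtPerm_castAdd u v a)

theorem mul_juxtPerm_comp_natAdd (w : Equiv.Perm (Fin (p + r))) (u : Equiv.Perm (Fin p))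
    (v : Equiv.Perm (Fin r)) : ⇑(w * juxtPerm u v) ∘ Fin.natAdd p = (w ∘ Fin.natAdd p) ∘ v :=
  funext fun a => congrArg w (juxtPerm_natAdd u v a)

theorem juxtPerm_inv (u : Equiv.Perm (Fin p)) (v : Equiv.Perm (Fin r)) :
    (juxtPerm u v)⁻¹ = juxtPerm u⁻¹ v⁻¹ := rfl

theorem isUnshuffle_inv_iff {w : Equiv.Perm (Fin (p + r))} : IsUnshuffle p w⁻¹ ↔
    StrictMono (w ∘ Fin.castAdd r) ∧ StrictMono (w ∘ Fin.natAdd p) := by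
  constructor
  · intro h
    exact ⟨fun a b hab => h _ _ ((Fin.strictMono_castAdd r) hab) (.inl (by simp)),
      fun a b hab => h _ _ (by simpa using hab) (.inr (by simp))⟩
  · rintro ⟨h_left, h_right⟩ i j hij hp
    rw [inv_inv]
    induction i using Fin.addCases with
    | left a =>
      induction j using Fin.addCases with
      | left b => exact h_left ((Fin.strictMono_castAdd r).lt_iff_lt.1 hij)
      | right b => simp only [Fin.val_castAdd, Fin.val_natAdd] at hp; omega
    | right a =>
      induction j using Fin.addCases with
      | left b => simp only [Fin.lt_def, Fin.val_castAdd, Fin.val_natAdd] at hij; omega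
      | right b => exact h_right (by simpa using hij)

theorem invCount_mul_juxtPerm {w : Equiv.Perm (Fin (p + r))} (hw : IsUnshuffle p w⁻¹)
    (u : Equiv.Perm (Fin p)) (v : Equiv.Perm (Fin r)) :
    invCount ⇑(w * juxtPerm u v) = invCount ⇑w + invCount ⇑u + invCount ⇑v := by
  obtain ⟨h_left, h_right⟩ := isUnshuffle_inv_iff.1 hw
  have h_cross : Finset.card {x : Fin p × Fin r |
        (w * juxtPerm u v) (Fin.natAdd p x.2) < (w * juxtPerm u v) (Fin.castAdd r x.1)} =
      Finset.card {x : Fin p × Fin r | w (Fin.natAdd p x.2) < w (Fin.castAdd r x.1)} :=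
    Finset.card_equiv (u.prodCongr v) (by simp [juxtPerm_castAdd, juxtPerm_natAdd])
  rw [invCount_add ⇑(w * juxtPerm u v), invCount_add ⇑w, h_cross, mul_juxtPerm_comp_castAdd,
    mul_juxtPerm_comp_natAdd, invCount_comp_of_strictMono h_left,
    invCount_comp_of_strictMono h_right, invCount_eq_zero_iff.2 h_left.monotone,
    invCount_eq_zero_iff.2 h_right.monotone]
  ring

theorem eq_of_strictMono_comp_perm_eq {m : ℕ} {α : Type*} [LinearOrder α] {f g : Fin m → α}
    (hf : StrictMono f) (hg : StrictMono g) {u v : Equiv.Perm (Fin m)} (h : f ∘ u = g ∘ v) :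
    u = v := by
  have hfg : f = g := by
    rw [← hf.range_inj hg, ← u.surjective.range_comp f, h, v.surjective.range_comp g]
  subst hfg
  exact DFunLike.coe_injective (hf.injective.comp_left h)

theorem eq_of_mul_juxtPerm_eq {w w' : Equiv.Perm (Fin (p + r))} (hw : IsUnshuffle p w⁻¹)
    (hw' : IsUnshuffle p w'⁻¹) {u u' : Equiv.Perm (Fin p)} {v v' : Equiv.Perm (Fin r)}
    (h : w * juxtPerm u v = w' * juxtPerm u' v') : w = w' ∧ u = u' ∧ v = v' := by
  obtain ⟨h_left, h_right⟩ := isUnshuffle_inv_iff.1 hw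
  obtain ⟨h_left', h_right'⟩ := isUnshuffle_inv_iff.1 hw'
  obtain rfl : u = u' := eq_of_strictMono_comp_perm_eq h_left h_left' <| by
    rw [← mul_juxtPerm_comp_castAdd w u v, h, mul_juxtPerm_comp_castAdd]
  obtain rfl : v = v' := eq_of_strictMono_comp_perm_eq h_right h_right' <| by
    rw [← mul_juxtPerm_comp_natAdd w u v, h, mul_juxtPerm_comp_natAdd]
  exact ⟨mul_right_cancel h, rfl, rfl⟩

theorem exists_isUnshuffle_inv_mul_juxtPerm (w : Equiv.Perm (Fin (p + r))) :
    ∃ u v, IsUnshuffle p (w * juxtPerm u v)⁻¹ := by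
  refine ⟨Tuple.sort (w ∘ Fin.castAdd r), Tuple.sort (w ∘ Fin.natAdd p),
    isUnshuffle_inv_iff.2 ⟨?_, ?_⟩⟩
  · rw [mul_juxtPerm_comp_castAdd]
    exact (Tuple.monotone_sort _).strictMono_of_injective
      ((w.injective.comp (Fin.castAdd_injective p r)).comp (Equiv.injective _))
  · rw [mul_juxtPerm_comp_natAdd]
    exact (Tuple.monotone_sort _).strictMono_of_injective
      ((w.injective.comp (Fin.natAdd_injective r p)).comp (Equiv.injective _))

end Shuffles

section GeneratingFunctions

variable {K : Type*} [CommSemiring K] (q : K)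

/-- The generating function `∑ q ^ inv(w)` of inversions, which is the `q`-factorial `[n]_q!`. -/
def invSum (n : ℕ) : K := ∑ w : Equiv.Perm (Fin n), q ^ invCount ⇑w

open Classical in
/-- The generating function of inversions of the `(p, n - p)`-unshuffles, which is the `q`-binomial
coefficient. -/
noncomputable def unshuffleInvSum (n p : ℕ) : K :=
  ∑ w : Equiv.Perm (Fin n) with IsUnshuffle p w, q ^ invCount ⇑w

theorem invSum_add (p r : ℕ) :
    invSum q (p + r) = unshuffleInvSum q (p + r) p * (invSum q p * invSum q r) := by
  simp only [invSum, unshuffleInvSum]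
  rw [Fintype.sum_mul_sum, ← Fintype.sum_prod_type', Finset.sum_mul_sum, ← Finset.sum_product']
  refine (Finset.sum_bij (fun x _ => x.1⁻¹ * juxtPerm x.2.1 x.2.2)
    (fun _ _ => Finset.mem_univ _) ?_ ?_ ?_).symm
  · rintro ⟨w, u, v⟩ hw ⟨w', u', v'⟩ hw' h
    have hw : IsUnshuffle p w⁻¹⁻¹ := by simpa using hw
    have hw' : IsUnshuffle p w'⁻¹⁻¹ := by simpa using hw'
    obtain ⟨h_inv, rfl, rfl⟩ := eq_of_mul_juxtPerm_eq hw hw' h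
    rw [inv_injective h_inv]
  · intro w _
    obtain ⟨u, v, hw⟩ := exists_isUnshuffle_inv_mul_juxtPerm w
    exact ⟨((w * juxtPerm u v)⁻¹, u⁻¹, v⁻¹), by simpa using hw,
      by rw [inv_inv, ← juxtPerm_inv, mul_inv_cancel_right]⟩
  · rintro ⟨w, u, v⟩ hw
    have hw : IsUnshuffle p w⁻¹⁻¹ := by simpa using hw
    rw [invCount_mul_juxtPerm hw, invCount_inv, pow_add, pow_add, mul_assoc]

/-- The permutation of `Fin (n + 1)` that sends `0` to `j` and is order isomorphic to `e` on the
remaining elements. -/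
def consPerm {n : ℕ} (j : Fin (n + 1)) (e : Equiv.Perm (Fin n)) : Equiv.Perm (Fin (n + 1)) :=
  j.cycleRange.symm * Equiv.Perm.decomposeFin.symm (0, e)

theorem consPerm_zero {n : ℕ} (j : Fin (n + 1)) (e : Equiv.Perm (Fin n)) : consPerm j e 0 = j := by
  simp [consPerm]

theorem consPerm_succ {n : ℕ} (j : Fin (n + 1)) (e : Equiv.Perm (Fin n)) (a : Fin n) :
    consPerm j e a.succ = j.succAbove (e a) := by
  simp [consPerm]

theorem invCount_succ {n : ℕ} {α : Type*} [LinearOrder α] (f : Fin (n + 1) → α) :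
    invCount f = Finset.card {b : Fin n | f b.succ < f 0} + invCount (f ∘ Fin.succ) := by
  simp [invCount_eq_sum, Fin.sum_univ_succ, Finset.card_filter, -Finset.sum_boole]

theorem invCount_consPerm {n : ℕ} (j : Fin (n + 1)) (e : Equiv.Perm (Fin n)) :
    invCount ⇑(consPerm j e) = j + invCount ⇑e := by
  have h_tail : ⇑(consPerm j e) ∘ Fin.succ = j.succAbove ∘ e := funext (consPerm_succ j e)
  have h_head : Finset.card {b : Fin n | consPerm j e b.succ < consPerm j e 0} = j := by
    simp only [consPerm_zero, consPerm_succ, Fin.succAbove_lt_iff_castSucc_lt]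
    calc _ = Finset.card {b : Fin n | (b : ℕ) < j} := Finset.card_equiv e (by simp [Fin.lt_def])
      _ = j := by rw [Fin.card_filter_val_lt]; omega
  rw [invCount_succ, h_head, h_tail, invCount_comp_of_strictMono j.strictMono_succAbove]

theorem consPerm_bijective (n : ℕ) :
    Function.Bijective fun x : Fin (n + 1) × Equiv.Perm (Fin n) => consPerm x.1 x.2 := by
  refine (Fintype.bijective_iff_injective_and_card _).2
    ⟨?_, by simp [Fintype.card_perm, Nat.factorial_succ]⟩
  rintro ⟨j, e⟩ ⟨j', e'⟩ h
  obtain rfl : j = j' := by simpa only [consPerm_zero] using DFunLike.congr_fun h 0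
  refine Prod.ext rfl (Equiv.ext fun a => j.succAbove_right_injective ?_)
  simpa only [consPerm_succ] using DFunLike.congr_fun h a.succ

theorem invSum_zero : invSum q 0 = 1 := by
  simp [invSum, invCount]

theorem invSum_succ (n : ℕ) :
    invSum q (n + 1) = (∑ j ∈ Finset.range (n + 1), q ^ j) * invSum q n := by
  simp only [invSum, ← (consPerm_bijective n).sum_comp, Fintype.sum_prod_type, Finset.sum_range,
    Fintype.sum_mul_sum, invCount_consPerm, pow_add]

end GeneratingFunctions

section BraidCharacter

variable {G : Type*}

theorem braidLift_of [Group G] {n : ℕ} (f : ℕ → G)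
    (hb : ∀ j, j + 1 < n - 1 → f j * f (j + 1) * f j = f (j + 1) * f j * f (j + 1))
    (hc : ∀ i j, i + 1 < j → j < n - 1 → f i * f j = f j * f i) (j : Fin (n - 1)) :
    braidLift f hb hc (PresentedGroup.of j) = f j :=
  PresentedGroup.toGroup.of _

variable [CommGroup G]

/-- The character of the braid group that sends each generator to `q`. -/
def braidChar (q : G) (n : ℕ) : BraidGroup n →* G :=
  braidLift (fun _ => q) (fun _ _ => rfl) (fun _ _ _ _ => rfl)

theorem braidChar_of (q : G) {n : ℕ} (j : Fin (n - 1)) :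
    braidChar q n (PresentedGroup.of j) = q :=
  braidLift_of _ _ _ _

theorem braidChar_braidGen (q : G) {n j : ℕ} (h : j < n - 1) :
    braidChar q n (braidGen n j) = q := by
  rw [braidGen, dif_pos h, braidChar_of]

theorem braidChar_matsumotoLift (q : G) {n : ℕ} (τ : Equiv.Perm (Fin n)) :
    braidChar q n (matsumotoLift τ) = q ^ invCount τ := by
  rw [← (exists_isReducedWord τ).choose_spec.length_eq, matsumotoLift, map_list_prod,
    bind_pure_val_eq_map_val, List.map_map, List.map_map]
  refine (List.prod_eq_pow_card _ q fun x hx => ?_).trans (by rw [List.length_map])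
  obtain ⟨j, -, rfl⟩ := List.mem_map.1 hx
  exact braidChar_braidGen q j.2

theorem braidChar_insertHom (q : G) {m l n : ℕ} (h : m + l = n + 1) (i : Fin m)
    (ρ : BraidGroup l) : braidChar q n (insertHom h i ρ) = braidChar q l ρ := by
  suffices h_comp : (braidChar q n).comp (insertHom h i) = braidChar q l from
    DFunLike.congr_fun h_comp ρ
  refine PresentedGroup.ext fun j => ?_
  rw [MonoidHom.comp_apply, braidChar_of, insertHom, braidLift_of]
  exact braidChar_braidGen q (by omega)

theorem exists_indexFamily_le_ker_braidChar [Finite G] (q : G) (n : ℕ) :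
    ∃ P : IndexFamily n, ∀ l, (P.1 l).toSubgroup ≤ (braidChar q l).ker := by
  obtain ⟨P, hP, -⟩ := exists_indexFamily_le (n := n) fun l => .ofSubgroup (braidChar q l).ker
  exact ⟨P, hP⟩

variable {k K : Type*} [Field k] [CommSemiring K] [Algebra k K] (ψ : G →* K) (q : G)

/-- The character of the group algebra of a finite quotient of the braid group that is induced by
`braidChar q` and a character `ψ` of its target. -/
noncomputable def quotChar {n : ℕ} (N : BraidQuot n) (hN : N.toSubgroup ≤ (braidChar q n).ker) :
    QuotAlg k N →ₐ[k] K :=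
  MonoidAlgebra.lift k K _ (ψ.comp (QuotientGroup.lift N.toSubgroup (braidChar q n) hN))

variable {n : ℕ} {N : BraidQuot n} (hN : N.toSubgroup ≤ (braidChar q n).ker)

theorem quotChar_single_mk (g : BraidGroup n) (a : k) :
    quotChar ψ q N hN (MonoidAlgebra.single (g : BraidGroup n ⧸ N.toSubgroup) a) =
      a • ψ (braidChar q n g) := by
  simp [quotChar, MonoidAlgebra.lift_single]

theorem quotChar_toQuotAlg_matsumotoLift (τ : Equiv.Perm (Fin n)) :
    quotChar ψ q N hN (toQuotAlg k N (MonoidAlgebra.single (matsumotoLift τ) 1)) =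
      ψ q ^ invCount τ := by
  rw [toQuotAlg, MonoidAlgebra.mapDomainRingHom_apply, MonoidAlgebra.mapDomain_single,
    QuotientGroup.mk'_apply, quotChar_single_mk, one_smul, braidChar_matsumotoLift, map_pow]

theorem quotChar_symmetrizer :
    quotChar ψ q N hN (toQuotAlg k N (symmetrizer k n)) = invSum (ψ q) n := by
  simp only [symmetrizer, map_sum, quotChar_toQuotAlg_matsumotoLift, invSum]

theorem quotChar_unshuffleSum (p : ℕ) :
    quotChar ψ q N hN (toQuotAlg k N (unshuffleSum k n p)) = unshuffleInvSum (ψ q) n p := by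
  simp only [unshuffleSum, map_sum, quotChar_toQuotAlg_matsumotoLift, unshuffleInvSum]

section Composition

variable {m l : ℕ} {h : m + l = n + 1} {i : Fin m} {P : BraidQuot m} {Q : BraidQuot l}
  (hA : Admissible h i P Q N) (hQ : Q.toSubgroup ≤ (braidChar q l).ker)

theorem quotChar_single_cableQuot (γ : BraidGroup m) (y : BraidGroup l ⧸ Q.toSubgroup) (a b : k) :
    quotChar ψ q N hN (MonoidAlgebra.single (cableQuot hA γ y) (a * b)) =
      a • ψ (braidChar q n ((cableHom h γ).left ((cableHom h γ).right i))) *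
        quotChar ψ q Q hQ (MonoidAlgebra.single y b) := by
  obtain ⟨ρ, rfl⟩ := QuotientGroup.mk_surjective y
  refine (quotChar_single_mk ψ q hN (cable h i γ ρ) _).trans ?_
  rw [quotChar_single_mk, cable, map_mul, braidChar_insertHom, map_mul, smul_mul_smul_comm]

theorem quotChar_dvd_quotChar_circ (α : QuotAlg k P) (β : QuotAlg k Q) :
    quotChar ψ q Q hQ β ∣ quotChar ψ q N hN (circ hA α β) := by
  simp only [circ, Finsupp.sum, map_sum]
  refine Finset.dvd_sum fun x _ => ?_
  obtain ⟨γ, rfl⟩ := QuotientGroup.mk_surjective x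
  simp only [quotChar_single_cableQuot ψ q hN hA hQ]
  rw [← Finset.mul_sum, ← map_sum]
  exact dvd_mul_of_dvd_right
    (dvd_of_eq (congrArg _ (MonoidAlgebra.sum_coeff_single β).symm)) _

end Composition

theorem quotChar_eq_zero_of_mem_decomposables {C M : BraidedSubseq k} {P : IndexFamily n}
    (hP : ∀ l, (P.1 l).toSubgroup ≤ (braidChar q l).ker)
    (hM : ∀ l, 2 ≤ l → l < n → ∀ β ∈ M.obj (P.1 l), quotChar ψ q _ (hP l) β = 0) :
    ∀ v ∈ decomposables C M P, quotChar ψ q _ (hP n) v = 0 := by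
  intro v hv
  induction hv using Submodule.span_induction with
  | mem x hx =>
    obtain ⟨m, l, h, hm, hl, i, α, -, β, hβ, rfl⟩ := hx
    exact zero_dvd_iff.1 (hM l hl (by omega) β hβ ▸ quotChar_dvd_quotChar_circ ψ q _ _ (hP l) α β)
  | zero => exact map_zero _
  | add x y _ _ hx hy => rw [map_add, hx, hy, add_zero]
  | smul a x _ hx => rw [quotAlg_smul_def, map_mul, hx, zero_mul]

end BraidCharacter

section RootsOfUnity

variable {n : ℕ} {K : Type*} [CommRing K] [IsDomain K] {ζ : K}

theorem invSum_ne_zero (hζ : IsPrimitiveRoot ζ n) {l : ℕ} (hl : l < n) : invSum ζ l ≠ 0 := by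
  induction l with
  | zero => exact invSum_zero ζ ▸ one_ne_zero
  | succ l ih =>
    rw [invSum_succ]
    refine mul_ne_zero (fun h_sum => ?_) (ih (by omega))
    have h_pow := geom_sum_mul ζ (l + 1)
    rw [h_sum, zero_mul] at h_pow
    exact hζ.pow_ne_one_of_pos_of_lt l.succ_ne_zero hl (sub_eq_zero.1 h_pow.symm)

theorem invSum_eq_zero (hζ : IsPrimitiveRoot ζ n) (hn : 2 ≤ n) : invSum ζ n = 0 := by
  obtain ⟨m, rfl⟩ := Nat.exists_eq_add_of_le' (one_le_two.trans hn)
  rw [invSum_succ, hζ.geom_sum_eq_zero (by omega), zero_mul]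

theorem unshuffleInvSum_eq_zero (hζ : IsPrimitiveRoot ζ n) {p : ℕ} (hp : p ∈ Set.Ioo 0 n) :
    unshuffleInvSum ζ n p = 0 := by
  obtain ⟨hp0, hpn⟩ := hp
  obtain ⟨r, rfl⟩ := Nat.exists_eq_add_of_le hpn.le
  have h_prod := invSum_add ζ p r
  rw [invSum_eq_zero hζ (by omega), zero_eq_mul] at h_prod
  exact h_prod.resolve_right
    (mul_ne_zero (invSum_ne_zero hζ hpn) (invSum_ne_zero hζ (by omega)))

theorem unshuffleInvSum_ne_zero (hζ : IsPrimitiveRoot ζ n) {l p : ℕ} (hp : p ≤ l) (hl : l < n) :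
    unshuffleInvSum ζ l p ≠ 0 := by
  obtain ⟨r, rfl⟩ := Nat.exists_eq_add_of_le hp
  exact left_ne_zero_of_mul (invSum_add ζ p r ▸ invSum_ne_zero hζ hl)

variable {k : Type*} [Field k] [Algebra k K] {G : Type*} [CommGroup G] {ψ : G →* K} {q : G}
  {l : ℕ} {N : BraidQuot l} (hN : N.toSubgroup ≤ (braidChar q l).ker)

theorem quotChar_eq_zero_of_mem_woronowicz (hq : IsPrimitiveRoot (ψ q) n) (hl : l < n) :
    ∀ β ∈ (BraidedSubseq.woronowicz k).obj N, quotChar ψ q N hN β = 0 := by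
  intro β hβ
  have h_prod := congrArg (quotChar ψ q N hN) (BraidedSubseq.mem_woronowicz_obj.1 hβ)
  rw [map_mul, map_zero, quotChar_symmetrizer] at h_prod
  exact (mul_eq_zero.1 h_prod).resolve_left (invSum_ne_zero hq hl)

theorem quotChar_eq_zero_of_mem_brPrim (hq : IsPrimitiveRoot (ψ q) n) (hl2 : 2 ≤ l) (hl : l < n) :
    ∀ β ∈ (BraidedSubseq.brPrim k).obj N, quotChar ψ q N hN β = 0 := by
  intro β hβ
  have h_prod := congrArg (quotChar ψ q N hN)
    ((BraidedSubseq.mem_brPrim_obj hl2).1 hβ 1 ⟨one_pos, hl2⟩)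
  rw [map_mul, map_zero, quotChar_unshuffleSum] at h_prod
  exact (mul_eq_zero.1 h_prod).resolve_left (unshuffleInvSum_ne_zero hq (by omega) hl)

variable [CharZero k] {P : IndexFamily n} (hP : ∀ l, (P.1 l).toSubgroup ≤ (braidChar q l).ker)
include hP

theorem exists_garsia_generator_brPrim (C : BraidedSubseq k) (hn : 2 ≤ n)
    (hq : IsPrimitiveRoot (ψ q) n) :
    ∃ g : ProLimit ((BraidedSubseq.brPrim k).pro n), IsGarsiaElement _ g ∧ IsProGenerator _ g ∧
      IsProGenerator (indec C _ n) (toIndec C _ g) ∧ (toIndec C _ g).term P ≠ 0 := by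
  refine (BraidedSubseq.isRationalAnnihilator_brPrim k hn).exists_garsia_generator C P
    (quotChar ψ q _ (hP n)).toRingHom (Set.forall_mem_image.2 fun p hp => ?_)
    (quotChar_eq_zero_of_mem_decomposables ψ q hP fun l hl hln =>
      quotChar_eq_zero_of_mem_brPrim (hP l) hq hl hln)
  rw [BraidedSubseq.ratToQuotAlg_unshuffleSum]
  exact (quotChar_unshuffleSum ψ q (hP n) p).trans (unshuffleInvSum_eq_zero hq hp)

theorem exists_garsia_generator_woronowicz (C : BraidedSubseq k) (hn : 2 ≤ n)
    (hq : IsPrimitiveRoot (ψ q) n) :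
    ∃ g : ProLimit ((BraidedSubseq.woronowicz k).pro n), IsGarsiaElement _ g ∧
      IsProGenerator _ g ∧ IsProGenerator (indec C _ n) (toIndec C _ g) ∧
      (toIndec C _ g).term P ≠ 0 := by
  refine (BraidedSubseq.isRationalAnnihilator_woronowicz k n).exists_garsia_generator C P
    (quotChar ψ q _ (hP n)).toRingHom (forall_eq.2 ?_)
    (quotChar_eq_zero_of_mem_decomposables ψ q hP fun l _ hln =>
      quotChar_eq_zero_of_mem_woronowicz (hP l) hq hln)
  rw [BraidedSubseq.ratToQuotAlg_symmetrizer]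
  exact (quotChar_symmetrizer ψ q (hP n)).trans (invSum_eq_zero hq hn)

end RootsOfUnity

theorem mainTheorem9_general (k : Type*) [Field k] [CharZero k] (n : ℕ) (hn : 2 ≤ n)
    (C : BraidedSubseq k) {M : BraidedSubseq k} (hM : M = .brPrim k ∨ M = .woronowicz k) :
    ¬ IsProZero (M.pro n) ∧ IsProCyclic (M.pro n) ∧
      ¬ IsProZero (indec C M n) ∧ IsProCyclic (indec C M n) ∧
      ∃ g : ProLimit (M.pro n), IsGarsiaElement M g ∧ IsProGenerator (M.pro n) g ∧
        IsProGenerator (indec C M n) (toIndec C M g) ∧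
        ∃ P : IndexFamily n, (toIndec C M g).term P ≠ 0 := by
  have : NeZero n := ⟨by omega⟩
  have := AlgebraicClosure.instCharZero k
  obtain ⟨ζ, hζ⟩ := HasEnoughRootsOfUnity.exists_primitiveRoot (AlgebraicClosure k) n
  let q : rootsOfUnity n (AlgebraicClosure k) := hζ.toRootsOfUnity
  let ψ : rootsOfUnity n (AlgebraicClosure k) →* AlgebraicClosure k :=
    (Units.coeHom _).comp (rootsOfUnity n _).subtype
  have hq : IsPrimitiveRoot (ψ q) n := hζ
  obtain ⟨P, hP⟩ := exists_indexFamily_le_ker_braidChar q n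
  obtain ⟨g, hg, h_gen, h_gen_indec, h_ne⟩ : ∃ g : ProLimit (M.pro n), IsGarsiaElement M g ∧
      IsProGenerator (M.pro n) g ∧ IsProGenerator (indec C M n) (toIndec C M g) ∧
      (toIndec C M g).term P ≠ 0 := by
    rcases hM with rfl | rfl
    · exact exists_garsia_generator_brPrim hP C hn hq
    · exact exists_garsia_generator_woronowicz hP C hn hq
  exact ⟨not_isProZero_of_term_ne_zero (BraidedSubseq.term_ne_zero_of_toIndec_term_ne_zero C h_ne),
    ⟨g, h_gen⟩, not_isProZero_of_term_ne_zero h_ne, ⟨_, h_gen_indec⟩,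
    g, hg, h_gen, h_gen_indec, P, h_ne⟩

theorem mainTheorem9 (k : Type*) [Field k] [CharZero k] (n : ℕ) (hn : 2 ≤ n) :
    (¬ IsProZero ((BraidedSubseq.brPrim k).pro n) ∧
      IsProCyclic ((BraidedSubseq.brPrim k).pro n) ∧
      ¬ IsProZero (indec (BraidedSubseq.brPrim k) (BraidedSubseq.brPrim k) n) ∧
      IsProCyclic (indec (BraidedSubseq.brPrim k) (BraidedSubseq.brPrim k) n) ∧
      ∃ g : ProLimit ((BraidedSubseq.brPrim k).pro n),
        IsGarsiaElement (BraidedSubseq.brPrim k) g ∧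
        IsProGenerator ((BraidedSubseq.brPrim k).pro n) g ∧
        IsProGenerator (indec (BraidedSubseq.brPrim k) (BraidedSubseq.brPrim k) n)
          (toIndec (BraidedSubseq.brPrim k) (BraidedSubseq.brPrim k) g) ∧
        ∃ P : IndexFamily n,
          (toIndec (BraidedSubseq.brPrim k) (BraidedSubseq.brPrim k) g).term P ≠ 0) ∧
    (¬ IsProZero ((BraidedSubseq.woronowicz k).pro n) ∧
      IsProCyclic ((BraidedSubseq.woronowicz k).pro n) ∧
      ¬ IsProZero (indec (BraidedSubseq.brAssGtOne k) (BraidedSubseq.woronowicz k) n) ∧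
      IsProCyclic (indec (BraidedSubseq.brAssGtOne k) (BraidedSubseq.woronowicz k) n) ∧
      ∃ g : ProLimit ((BraidedSubseq.woronowicz k).pro n),
        IsGarsiaElement (BraidedSubseq.woronowicz k) g ∧
        IsProGenerator ((BraidedSubseq.woronowicz k).pro n) g ∧
        IsProGenerator (indec (BraidedSubseq.brAssGtOne k) (BraidedSubseq.woronowicz k) n)
          (toIndec (BraidedSubseq.brAssGtOne k) (BraidedSubseq.woronowicz k) g) ∧
        ∃ P : IndexFamily n,
          (toIndec (BraidedSubseq.brAssGtOne k) (BraidedSubseq.woronowicz k) g).term P ≠ 0) :=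
  ⟨mainTheorem9_general k n hn _ (.inl rfl), mainTheorem9_general k n hn _ (.inr rfl)⟩
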